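/- **Setting.** A Petri net $\mathcal N=(P,T,W^-,W^+)$ has finite sets $P$ of places and $T$ of transitions and matrices $W^\pm\in\mathbb N^{P\times T}$, with $W^-(t)\ne W^+(t)$ for all $t$ and $(W^-(t),W^+(t))\neq(W^-(t'),W^+(t'))$ for $t\ne t'$. A marking is a vector $m\in\mathbb N^P$; $t$ is enabled at $m$ if $m\ge W^-(t)$, and then firing it leads to $m-W^-(t)+W^+(t)$. $\mathcal R(m)$ denotes the set of markings reachable from $m$, and $m_0$ is live if for all $t\in T$ and $m\in\mathcal R(m_0)$ some $m'\in\mathcal R(m)$ enables $t$. The bag graph has the vertices (bags) $V_{\mathcal N}=\{W^-(t),W^+(t)\mid t\in T\}$ and an edge $W^-(t)\to W^+(t)$ for each $t\in T$. Given rates $\lambda:T\to\mathbb R_{>0}$, the marked stochastic net $(\mathcal N,\lambda,m_0)$ defines the continuous-time Markov chain on $\mathcal R(m_0)$ with generator $\mathbf Q(m,m')=\sum_{t:\,m\xrightarrow{t}m'}\lambda(t)$ for $m\ne m'$ and $\mathbf Q(m,m)=-\sum_{m'\neq m}\mathbf Q(m,m')$. It is *ergodic* if this chain is irreducible and has a steady-state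 distribution, that is, a probability distribution $\pi$ on $\mathcal R(m_0)$ with $\pi\cdot\mathbf Q=0$. An $N$-closed $\Pi^3$-net is a Petri net with a bijection $p\mapsto b_p$ from $P$ onto $V_{\mathcal N}$ such that $b_p(p)=1$ for all $p$; such that the bag graph has exactly $N$ connected components $V_1,\dots,V_N$, each of them strongly connected; and such that, with $\mathsf{pot}(p)=\sum_q b_p(q)-1$, $P_i=\{p\mid b_p\in V_i\}$, $P_i^{\max}$ the set of $p\in P_i$ of maximal potential, and $P_0=P_0^{\max}=\emptyset$: if $b\in V_i$ and $p\in P$ satisfy $b\neq b_p$ and $b(p)>0$, then $p\in P_{i-1}^{\max}$. An $N$-open $\Pi^3$-net is obtained from an $N$-closed one by deleting one place $p_{\mathsf{ext}}\in P_N$ (after which $P_N$ no longer contains $p_{\mathsf{ext}}$); potentials are those of the closed net. In it, for $p\in P_N$, $\mathsf{cin}(p)=\mathsf{pot}(p_{\mathsf{ext}})-\mathsf{pot}(p)$. For a bag $b$ of $\mathcal N$, a witness is a vector $\mathit{wit}_b\in\mathbb Q^P$ such that $\mathit{wit}_b\cdot(W^+(t)-W^-(t))$ equals $-1$ if $W^-(t)=b$,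 equals $1$ if $W^+(t)=b$, and equals $0$ otherwise. Put $\lambda(b)=\sum_{t:\,W^-(t)=b}\lambda(t)$, let $\mathbf P$ be the routing matrix on bags with $\mathbf P(W^-(t),W^+(t))=\lambda(t)/\lambda(W^-(t))$ for $t\in T$ and all other entries $0$, and let $\mathbf{vis}$ be a positive solution of $\mathbf{vis}\cdot\mathbf P=\mathbf{vis}$. For a choice of witnesses and of $\mathbf{vis}$, the product-form constants are $\mu_p=\prod_{b\in V_{\mathcal N}}(\mathbf{vis}(b)/\lambda(b))^{\mathit{wit}_b(p)}$, $p\in P$. **Theorem.** Let $(\mathcal N,\lambda)$ be a stochastic $N$-open $\Pi^3$-net. Witnesses of all bags and a positive solution $\mathbf{vis}$ exist. For every choice of them, with product-form constants $\mu_p$, and for every live marking $m_0$, the net $(\mathcal N,\lambda,m_0)$ is ergodic if and only if all of the following hold: 1. for all $p\in P_N$ with $\mathsf{cin}(p)=0$: $\mu_p<1$; 2. for all $p,q\in P_N$ with $\mathsf{cin}(p)>0>\mathsf{cin}(q)$: $\mu_p^{|\mathsf{cin}(q)|}\mu_q^{\mathsf{cin}(p)}<1$; 3. for all $p\in P_{N-1}^{\max}$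 and $q\in P_N$ with $\mathsf{cin}(q)<0$: $\mu_p^{|\mathsf{cin}(q)|}\mu_q<1$. In particular, ergodicity does not depend on the live initial marking: if $m_0$ and $m_1$ are live, then $(\mathcal N,\lambda,m_0)$ is ergodic if and only if $(\mathcal N,\lambda,m_1)$ is. -/

import Mathlib

/-- A Petri net with places `P` and transitions `T`. The bag `pre t` (resp. `post t`) is the column
of `t` in the backward (resp. forward) incidence matrix. There are neither useless nor duplicated
transitions. -/
structure PetriNet (P T : Type*) where
  pre : T → P → ℕ
  post : T → P → ℕ
  pre_ne_post : ∀ t, pre t ≠ post t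
  not_duplicated : ∀ t t', t ≠ t' → pre t ≠ pre t' ∨ post t ≠ post t'

namespace PetriNet

variable {P T : Type*} (N : PetriNet P T)

section Dynamics

/-- Transition `t` is enabled in the marking `m`. -/
def Enabled (t : T) (m : P → ℕ) : Prop := ∀ p, N.pre t p ≤ m p

/-- The firing of `t` leads from `m` to `m'`. -/
def Fires (t : T) (m m' : P → ℕ) : Prop :=
  N.Enabled t m ∧ ∀ p, m' p = m p - N.pre t p + N.post t p

/-- `N.Reachable m m'` says that `m'` is in the reachability set of `m`. -/
def Reachable (m m' : P → ℕ) : Prop :=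
  Relation.ReflTransGen (fun x y => ∃ t, N.Fires t x y) m m'

/-- The marking `m₀` is live. -/
def IsLive (m₀ : P → ℕ) : Prop :=
  ∀ t m, N.Reachable m₀ m → ∃ m', N.Reachable m m' ∧ N.Enabled t m'

end Dynamics

section MarkovChain

variable [Fintype T]

open Classical in
/-- The rate at which the chain jumps from `m` to another marking `m'`. -/
noncomputable def jumpRate (rate : T → ℝ) (m m' : P → ℕ) : ℝ :=
  ∑ t with N.Fires t m m', rate t

open Classical in
/-- The infinitesimal generator. (Only finitely many terms of the sum on the diagonal are
nonzero.) -/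
noncomputable def generator (rate : T → ℝ) (m m' : P → ℕ) : ℝ :=
  if m = m' then -∑' x : {x : P → ℕ // x ≠ m}, N.jumpRate rate m x
  else N.jumpRate rate m m'

/-- The state space of the chain started in `m₀`: its reachability set. -/
abbrev State (m₀ : P → ℕ) : Type _ := {m : P → ℕ // N.Reachable m₀ m}

/-- `π` is a steady-state distribution: a probability distribution on the state space
with `π ⬝ Q = 0`. -/
structure IsSteadyState (rate : T → ℝ) (m₀ : P → ℕ) (π : N.State m₀ → ℝ) : Prop where
  nonneg : ∀ m, 0 ≤ π m
  total : HasSum π 1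
  invariant : ∀ m' : N.State m₀, HasSum (fun m : N.State m₀ => π m * N.generator rate m m') 0

/-- The marked stochastic net is ergodic: its Markov chain is irreducible and has a steady-state
distribution. -/
def IsErgodic (rate : T → ℝ) (m₀ : P → ℕ) : Prop :=
  (∀ m m' : N.State m₀, N.Reachable m m') ∧ ∃ π, N.IsSteadyState rate m₀ π

end MarkovChain

section Bags

variable [Fintype T]

open Classical in
/-- The vertices of the bag graph. -/
noncomputable def bags : Finset (P → ℕ) :=
  Finset.univ.image N.pre ∪ Finset.univ.image N.post

/-- The edges of the bag graph. -/
def BagEdge (b b' : P → ℕ) : Prop := ∃ t, N.pre t = b ∧ N.post t = b'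

open Classical in
/-- `w` is a witness of the bag `b`. -/
def IsWitness [Fintype P] (b : P → ℕ) (w : P → ℚ) : Prop :=
  ∀ t, ∑ p, w p * ((N.post t p : ℚ) - (N.pre t p : ℚ)) =
    if N.pre t = b then -1 else if N.post t = b then 1 else 0

open Classical in
/-- The firing rate of a bag. -/
noncomputable def bagRate (rate : T → ℝ) (b : P → ℕ) : ℝ :=
  ∑ t with N.pre t = b, rate t

open Classical in
/-- The routing matrix of bags. -/
noncomputable def routing (rate : T → ℝ) (b b' : P → ℕ) : ℝ :=
  ∑ t with N.pre t = b ∧ N.post t = b', rate t / N.bagRate rate b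

/-- `vis` is a positive solution of `vis ⬝ routing = vis`. -/
def IsVisit (rate : T → ℝ) (vis : (P → ℕ) → ℝ) : Prop :=
  (∀ b ∈ N.bags, 0 < vis b) ∧
    ∀ b' ∈ N.bags, ∑ b ∈ N.bags, vis b * N.routing rate b b' = vis b'

/-- `μ` is the family of product-form constants given by some choice of witnesses of the bags and
of visit ratios. -/
def IsProductForm [Fintype P] (rate : T → ℝ) (μ : P → ℝ) : Prop :=
  ∃ (wit : (P → ℕ) → P → ℚ) (vis : (P → ℕ) → ℝ),
    (∀ b ∈ N.bags, N.IsWitness b (wit b)) ∧ N.IsVisit rate vis ∧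
    ∀ p, μ p = ∏ b ∈ N.bags, (vis b / N.bagRate rate b) ^ ((wit b p : ℚ) : ℝ)

end Bags

end PetriNet

section Pi3

variable {P T : Type*}

/-- The potential of a place `p` with associated bag `bag p`. -/
def potential [Fintype P] (bag : P → P → ℕ) (p : P) : ℕ := ∑ q, bag p q - 1

/-- The places of maximal potential in layer `i`. -/
def maxPlaces [Fintype P] (layer : P → ℕ) (bag : P → P → ℕ) (i : ℕ) : Set P :=
  {p | layer p = i ∧ ∀ q, layer q = i → potential bag q ≤ potential bag p}

/-- The structure of an `n`-closed `Π³`-net on a Petri net. The function `bag` is the bijection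
between places and bags, and the place `p` belongs to the layer `layer p`, that is, the bag of `p`
belongs to the component of the bag graph with number `layer p`. -/
structure ClosedPi3 [Fintype P] [Fintype T] (N : PetriNet P T) (n : ℕ) where
  bag : P → P → ℕ
  bag_bijOn : Set.BijOn bag Set.univ N.bags
  bag_self : ∀ p, bag p p = 1
  layer : P → ℕ
  layer_mem : ∀ p, 1 ≤ layer p ∧ layer p ≤ n
  layer_surj : ∀ i, 1 ≤ i → i ≤ n → ∃ p, layer p = i
  /-- The layers are exactly the components of the bag graph, and each of them is strongly
  connected. -/
  layer_eq_iff : ∀ p q, layer p = layer q ↔ Relation.ReflTransGen N.BagEdge (bag p) (bag q)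
  resource : ∀ p q, q ≠ p → 0 < bag p q → q ∈ maxPlaces layer bag (layer p - 1)

/-- The structure of an `n`-open `Π³`-net on a Petri net `N` with places `P`: an `n`-closed
`Π³`-net with places `P` and one more place `none` (called `p_ext`), which lies in layer `n` and
whose deletion gives `N`. -/
structure OpenPi3 [Fintype P] [Fintype T] (N : PetriNet P T) (n : ℕ) where
  closedNet : PetriNet (Option P) T
  pi3 : ClosedPi3 closedNet n
  layer_ext : pi3.layer none = n
  pre_eq : ∀ t p, N.pre t p = closedNet.pre t (some p)
  post_eq : ∀ t p, N.post t p = closedNet.post t (some p)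

namespace OpenPi3

variable [Fintype P] [Fintype T] {N : PetriNet P T} {n : ℕ} (S : OpenPi3 N n)

/-- The set of places `P_i`. -/
def places (i : ℕ) : Set P := {p | S.pi3.layer (some p) = i}

/-- The set of places `P_i^max`, for `i < n`. -/
def maxPlaces (i : ℕ) : Set P := {p | some p ∈ _root_.maxPlaces S.pi3.layer S.pi3.bag i}

/-- The potential of a place. -/
def pot (p : P) : ℕ := potential S.pi3.bag (some p)

open Classical in
/-- The reference potential of a layer: the maximal one, and that of `p_ext` for layer `n`. -/
noncomputable def POT (i : ℕ) : ℕ :=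
  if i = n then potential S.pi3.bag none
  else (Finset.univ.filter (fun p => p ∈ S.places i)).sup S.pot

/-- The number `cin(p) = POT_i - pot(p)`, for `p` in `P_i`. -/
noncomputable def cin (p : P) : ℤ := (S.POT (S.pi3.layer (some p)) : ℤ) - (S.pot p : ℤ)

end OpenPi3

end Pi3

/-! The components of the bag graph are strongly connected, so every firing can be undone and the
chain is irreducible. The witnesses and the balance of visits make ν(m) = ∏ μ_p^{m(p)} an invariant
measure, and an irreducible chain with a stationary distribution has only finite invariant measures.
So ergodicity means that ν is summable over the reachability set
(`IsProductForm.isErgodic_iff_summable`).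

Sufficiency (`IsStable.summable`). Put ℓ = log μ. Any z with z_n = 0 gives a conservation law y(p) =
z_i + cin(p) z_{i-1} for p in layer i, and replacing ℓ by ℓ - y changes ν on the reachability set
only by a constant factor. If ℓ < y everywhere, products of geometric series bound the sum.
Conditions 1–3 say exactly that some value of z_{n-1} achieves this on P_n and P_{n-1}^max; for the
other places it is enough to take the remaining z_j large.

Necessity (`isStable_of_summable`). From a live marking one reaches a marking in which every layer
has the resources that the next one needs (`exists_good`); from there, resources can be
redistributed (`rearranges`). The deleted place acts as an inexhaustible source: drawing a token
from it into p consumes cin(p) tokens of P_{n-1}^max, or releases |cin(p)| if cin(p) < 0. Each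
condition belongs to an increment built from such moves that can be repeated forever; ν then
contains a geometric series, whose ratio must be less than one. -/

namespace PetriNet

/-! ### Firing, reachability and weak reversibility. -/

section Dynamics

variable {P T : Type*} (N : PetriNet P T)

theorem fires_add (t : T) (u : P → ℕ) : N.Fires t (u + N.pre t) (u + N.post t) :=
  ⟨fun p => by simp, fun p => by simp⟩

theorem fires_iff {t : T} {m m' : P → ℕ} :
    N.Fires t m m' ↔ ∃ u, m = u + N.pre t ∧ m' = u + N.post t := by
  constructor
  · rintro ⟨h, h'⟩
    refine ⟨m - N.pre t, ?_, ?_⟩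
    · funext p
      have := h p
      simp only [Pi.add_apply, Pi.sub_apply]
      omega
    · funext p
      simp [h' p]
  · rintro ⟨u, rfl, rfl⟩
    exact N.fires_add t u

variable {N}

theorem Fires.add {t : T} {m m' : P → ℕ} (h : N.Fires t m m') (u : P → ℕ) :
    N.Fires t (m + u) (m' + u) := by
  obtain ⟨v, rfl, rfl⟩ := N.fires_iff.1 h
  rw [add_right_comm v (N.pre t), add_right_comm v (N.post t)]
  exact N.fires_add t _

theorem Fires.ne {t : T} {m m' : P → ℕ} (h : N.Fires t m m') : m ≠ m' := by
  obtain ⟨v, rfl, rfl⟩ := N.fires_iff.1 h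
  exact fun h => N.pre_ne_post t (add_left_cancel h)

theorem Fires.eq_right {t : T} {m m' m'' : P → ℕ} (h : N.Fires t m m') (h' : N.Fires t m m'') :
    m' = m'' :=
  funext fun p => (h.2 p).trans (h'.2 p).symm

theorem Fires.eq_left {t : T} {m m' m'' : P → ℕ} (h : N.Fires t m m'') (h' : N.Fires t m' m'') :
    m = m' := by
  obtain ⟨u, rfl, rfl⟩ := N.fires_iff.1 h
  obtain ⟨v, rfl, hv⟩ := N.fires_iff.1 h'
  rw [add_right_cancel hv]

theorem enabled_iff {t : T} {m : P → ℕ} : N.Enabled t m ↔ ∃ m', N.Fires t m m' :=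
  ⟨fun h => ⟨_, h, fun _ => rfl⟩, fun ⟨_, h⟩ => h.1⟩

theorem Fires.reachable {t : T} {m m' : P → ℕ} (h : N.Fires t m m') : N.Reachable m m' :=
  Relation.ReflTransGen.single ⟨t, h⟩

theorem Reachable.trans {m m' m'' : P → ℕ} (h : N.Reachable m m') (h' : N.Reachable m' m'') :
    N.Reachable m m'' :=
  Relation.ReflTransGen.trans h h'

variable (N) in
theorem Reachable.refl (m : P → ℕ) : N.Reachable m m :=
  Relation.ReflTransGen.refl

theorem Reachable.add {m m' : P → ℕ} (h : N.Reachable m m') (u : P → ℕ) :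
    N.Reachable (m + u) (m' + u) := by
  induction h with
  | refl => exact Reachable.refl N _
  | tail _ h ih =>
    obtain ⟨t, ht⟩ := h
    exact ih.trans (ht.add u).reachable

/-- A marking that can be increased by `u` can be increased by any multiple of `u`. -/
theorem Reachable.add_nsmul {m u : P → ℕ} (h : N.Reachable m (m + u)) (k : ℕ) :
    N.Reachable m (m + k • u) := by
  induction k with
  | zero => simpa using Reachable.refl N m
  | succ k ih =>
    have := h.add (k • u)
    rw [add_assoc, ← succ_nsmul'] at this
    exact ih.trans this

/-- Along a path of bags, each transition consumes exactly the bag just produced, so the context `u`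
is never touched. -/
theorem reachable_of_bagPath {b b' : P → ℕ} (h : Relation.ReflTransGen N.BagEdge b b')
    (u : P → ℕ) : N.Reachable (u + b) (u + b') := by
  induction h with
  | refl => exact Reachable.refl N _
  | tail _ h ih =>
    obtain ⟨t, rfl, rfl⟩ := h
    exact ih.trans (N.fires_add t u).reachable

variable (N) in
/-- Every edge of the bag graph lies on a cycle. -/
def WeaklyReversible : Prop := ∀ t, Relation.ReflTransGen N.BagEdge (N.post t) (N.pre t)

/-- A firing replaces one bag in a fixed context; the rest of the bag cycle, run in the same
context, undoes it. -/
theorem WeaklyReversible.reachable_symm (hN : N.WeaklyReversible) {m m' : P → ℕ}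
    (h : N.Reachable m m') : N.Reachable m' m := by
  induction h with
  | refl => exact Reachable.refl N _
  | tail _ h ih =>
    obtain ⟨t, ht⟩ := h
    obtain ⟨u, rfl, rfl⟩ := N.fires_iff.1 ht
    exact (reachable_of_bagPath (hN t) u).trans ih

end Dynamics

/-! ### The generator as inflow minus outflow. -/

section MarkovChain

variable {P T : Type*} [Fintype T] (N : PetriNet P T)

theorem pre_mem_bags (t : T) : N.pre t ∈ N.bags := by
  simp [bags]

theorem post_mem_bags (t : T) : N.post t ∈ N.bags := by
  simp [bags]

/-- The path back from an output bag is not trivial, because `pre t ≠ post t`. This is what makes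
all bag rates positive. -/
theorem WeaklyReversible.exists_pre_eq {N : PetriNet P T} (hN : N.WeaklyReversible) {b : P → ℕ}
    (hb : b ∈ N.bags) : ∃ t, N.pre t = b := by
  simp only [bags, Finset.mem_union, Finset.mem_image, Finset.mem_univ, true_and] at hb
  obtain h | ⟨t, rfl⟩ := hb
  · exact h
  · obtain h | ⟨c, ⟨t', h, -⟩, -⟩ := (hN t).cases_head
    · exact absurd h.symm (N.pre_ne_post t)
    · exact ⟨t', h⟩

variable (rate : T → ℝ)

open Classical in
/-- The total rate at which the chain leaves `m`. -/
noncomputable def exitRate (m : P → ℕ) : ℝ := ∑ t with N.Enabled t m, rate t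

theorem jumpRate_self (m : P → ℕ) : N.jumpRate rate m m = 0 := by
  classical
  refine Finset.sum_eq_zero fun t ht => ?_
  exact absurd rfl (Finset.mem_filter.1 ht).2.ne

/-- Each enabled transition has exactly one target. The index family `i` is arbitrary so as to cover
both the diagonal of the generator and the state space. -/
theorem hasSum_jumpRate {X : Type*} {i : X → P → ℕ} (hi : Function.Injective i) {m : P → ℕ}
    (h : ∀ t m', N.Fires t m m' → m' ∈ Set.range i) :
    HasSum (fun x => N.jumpRate rate m (i x)) (N.exitRate rate m) := by
  classical
  simp only [jumpRate, exitRate, Finset.sum_filter]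
  refine hasSum_sum fun t _ => ?_
  by_cases ht : N.Enabled t m
  · obtain ⟨m', hm'⟩ := enabled_iff.1 ht
    obtain ⟨x, rfl⟩ := h t _ hm'
    convert hasSum_single x fun y hy => ?_ using 1
    · rw [if_pos ht, if_pos hm']
    · exact if_neg fun hf => hy (hi (hf.eq_right hm'))
  · rw [if_neg ht]
    convert hasSum_zero with x
    exact if_neg fun hf => ht hf.1

theorem hasSum_mul_jumpRate {X : Type*} {i : X → P → ℕ} (hi : Function.Injective i) {m' : P → ℕ}
    (h : ∀ t m, N.Fires t m m' → m ∈ Set.range i) (σ : (P → ℕ) → ℝ) :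
    open Classical in
    HasSum (fun x => σ (i x) * N.jumpRate rate (i x) m')
      (∑ t with N.post t ≤ m', σ (m' - N.post t + N.pre t) * rate t) := by
  classical
  simp only [jumpRate, Finset.sum_filter, Finset.mul_sum, mul_ite, mul_zero]
  refine hasSum_sum fun t _ => ?_
  by_cases ht : N.post t ≤ m'
  · have hf : N.Fires t (m' - N.post t + N.pre t) m' :=
      N.fires_iff.2 ⟨m' - N.post t, rfl, (tsub_add_cancel_of_le ht).symm⟩
    obtain ⟨x, hx⟩ := h t _ hf
    rw [← hx] at hf ⊢
    convert hasSum_single x fun y hy => ?_ using 1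
    · rw [if_pos ht, if_pos hf]
    · exact if_neg fun hf' => hy (hi (hf'.eq_left hf))
  · rw [if_neg ht]
    convert hasSum_zero with x
    refine if_neg fun hf => ht ?_
    obtain ⟨u, -, rfl⟩ := N.fires_iff.1 hf
    exact le_add_self

open Classical in
theorem generator_eq (m m' : P → ℕ) :
    N.generator rate m m' =
      N.jumpRate rate m m' - if m = m' then N.exitRate rate m else 0 := by
  by_cases h : m = m'
  · subst h
    have := N.hasSum_jumpRate rate (m := m) (i := fun x : {x : P → ℕ // x ≠ m} => (x : P → ℕ))
      Subtype.val_injective fun t m' hf => ⟨⟨m', hf.ne.symm⟩, rfl⟩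
    simp [generator, this.tsum_eq, jumpRate_self]
  · simp [generator, h]

variable {rate} (hrate : ∀ t, 0 < rate t)
include hrate

theorem jumpRate_nonneg (m m' : P → ℕ) : 0 ≤ N.jumpRate rate m m' :=
  Finset.sum_nonneg fun t _ => (hrate t).le

theorem jumpRate_pos {t : T} {m m' : P → ℕ} (h : N.Fires t m m') :
    0 < N.jumpRate rate m m' := by
  classical
  exact Finset.sum_pos (fun t _ => hrate t) ⟨t, by simpa using h⟩

theorem exitRate_le (m : P → ℕ) : N.exitRate rate m ≤ ∑ t, rate t := by
  classical
  exact Finset.sum_le_sum_of_subset_of_nonneg (Finset.filter_subset _ _) fun t _ _ => (hrate t).le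

theorem bagRate_pos {b : P → ℕ} (hb : ∃ t, N.pre t = b) : 0 < N.bagRate rate b := by
  classical
  obtain ⟨t, ht⟩ := hb
  exact Finset.sum_pos (fun t _ => hrate t) ⟨t, by simpa using ht⟩

end MarkovChain

end PetriNet

/-! ### Invariant measures and ergodicity. -/

/-- If an irreducible Markov chain has a stationary distribution, then all its invariant measures
are finite. -/
theorem summable_of_invariant_of_stationary {X : Type*} {K : X → X → ℝ} {π ν : X → ℝ}
    (hK : ∀ x y, 0 ≤ K x y) (hK1 : ∀ x, HasSum (K x) 1)
    (hirr : ∀ x y, Relation.ReflTransGen (fun x y => 0 < K x y) x y)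
    (hπ : ∀ x, 0 ≤ π x) (hπs : Summable π) (hπK : ∀ y, HasSum (fun x => π x * K x y) (π y))
    (hν : ∀ x, 0 ≤ ν x) (hνK : ∀ y, HasSum (fun x => ν x * K x y) (ν y))
    {x₀ : X} (hx₀ : 0 < π x₀) : Summable ν := by
  -- With this constant, ν and c π agree at `x₀`. Their minimum σ is summable and, being a minimum
  -- of invariant measures, satisfies σK ≤ σ.
  set c := ν x₀ / π x₀ with hc
  have hc0 : 0 ≤ c := div_nonneg (hν _) (hπ _)
  set σ : X → ℝ := fun x => min (ν x) (c * π x) with hσ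
  have hσ0 : ∀ x, 0 ≤ σ x := fun x => le_min (hν x) (mul_nonneg hc0 (hπ x))
  have hσν : ∀ x, σ x ≤ ν x := fun x => min_le_left _ _
  have hσπ : ∀ x, σ x ≤ c * π x := fun x => min_le_right _ _
  have hσs : Summable σ := Summable.of_nonneg_of_le hσ0 hσπ (hπs.mul_left c)
  have hrow : ∀ x, HasSum (fun y => σ x * K x y) (σ x) := fun x => by
    simpa using (hK1 x).mul_left (σ x)
  have hsum : Summable (fun z : X × X => σ z.1 * K z.1 z.2) := by
    rw [summable_prod_of_nonneg fun z => mul_nonneg (hσ0 _) (hK _ _)]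
    exact ⟨fun x => (hrow x).summable, by simpa only [(hrow _).tsum_eq] using hσs⟩
  have hcol : ∀ y, Summable (fun x => σ x * K x y) := fun y => hsum.prod_symm.prod_factor y
  have hcol_le : ∀ y, ∑' x, σ x * K x y ≤ σ y := fun y => by
    refine le_min ?_ ?_
    · exact hasSum_le (fun x => mul_le_mul_of_nonneg_right (hσν x) (hK x y)) (hcol y).hasSum
        (hνK y)
    · refine hasSum_le (fun x => ?_) (hcol y).hasSum ((hπK y).mul_left c)
      rw [← mul_assoc]
      exact mul_le_mul_of_nonneg_right (hσπ x) (hK x y)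
  have htotal : HasSum (fun y => ∑' x, σ x * K x y) (∑' x, σ x) := by
    have h1 : Summable (fun y => ∑' x, σ x * K x y) := hsum.prod_symm.prod
    have h2 : ∑' y, ∑' x, σ x * K x y = ∑' x, σ x := by
      rw [Summable.tsum_comm (f := fun x y => σ x * K x y) hsum]
      exact tsum_congr fun x => (hrow x).tsum_eq
    exact h2 ▸ h1.hasSum
  -- σK and σ have the same finite total mass, so σK ≤ σ is an equality.
  have hσK : ∀ y, HasSum (fun x => σ x * K x y) (σ y) := fun y => by
    have h := hσs.hasSum.sub htotal
    rw [sub_self, hasSum_zero_iff_of_nonneg fun y => sub_nonneg.2 (hcol_le y)] at h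
    have := sub_eq_zero.1 (congrFun h y)
    exact this ▸ (hcol y).hasSum
  have hD : ∀ y, HasSum (fun x => (ν x - σ x) * K x y) (ν y - σ y) := fun y => by
    simpa only [sub_mul] using (hνK y).sub (hσK y)
  -- A nonnegative invariant measure that vanishes at a point vanishes at all its predecessors.
  have hzero : ∀ x y, Relation.ReflTransGen (fun x y => 0 < K x y) x y → ν y - σ y = 0 →
      ν x - σ x = 0 := by
    intro x y hxy
    induction hxy with
    | refl => exact id
    | @tail b c _ h ih =>
      refine fun hy => ih ?_
      have := hD c
      rw [hy, hasSum_zero_iff_of_nonneg fun z => mul_nonneg (sub_nonneg.2 (hσν z)) (hK _ _)]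
        at this
      exact (mul_eq_zero.1 (congrFun this b)).resolve_right h.ne'
  have h0 : ν x₀ - σ x₀ = 0 := by
    simp [hσ, hc, hx₀.ne']
  refine hσs.congr fun x => ?_
  exact (sub_eq_zero.1 (hzero x x₀ (hirr x x₀) h0)).symm

namespace PetriNet

variable {P T : Type*} [Fintype T] {N : PetriNet P T} {rate : T → ℝ}

/-- The invariant measures of the chain in `N.State m₀` are those of its uniformization. -/
theorem hasSum_mul_generator_iff {m₀ : P → ℕ} {σ : N.State m₀ → ℝ} {m' : N.State m₀} {Λ : ℝ}
    (hΛ : 0 < Λ) :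
    open Classical in
    HasSum (fun m : N.State m₀ => σ m * N.generator rate m m') 0 ↔
      HasSum (fun m : N.State m₀ =>
        σ m * ((if m = m' then 1 else 0) + N.generator rate m m' / Λ)) (σ m') := by
  classical
  have h1 : HasSum (fun m : N.State m₀ => σ m * if m = m' then 1 else 0) (σ m') := by
    convert hasSum_single m' fun m hm => ?_ using 1
    · simp
    · simp [hm]
  constructor
  · intro h
    convert h1.add (h.div_const Λ) using 2
    · ring
    · simp
  · intro h
    have h2 := (h.sub h1).mul_right Λ
    rw [sub_self, zero_mul] at h2
    refine (funext fun m => ?_ : _ = fun m : N.State m₀ => _) ▸ h2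
    rw [← mul_sub, add_sub_cancel_left, mul_assoc, div_mul_cancel₀ _ hΛ.ne']

theorem WeaklyReversible.isErgodic_iff_summable (hN : N.WeaklyReversible)
    (hrate : ∀ t, 0 < rate t) {m₀ : P → ℕ} {ν : (P → ℕ) → ℝ} (hν : ∀ m, 0 < ν m)
    (hinv : ∀ m' : N.State m₀, HasSum (fun m : N.State m₀ => ν m * N.generator rate m m') 0) :
    N.IsErgodic rate m₀ ↔ Summable fun m : N.State m₀ => ν m := by
  classical
  have hirr : ∀ m m' : N.State m₀, N.Reachable m m' := fun m m' =>
    (hN.reachable_symm m.2).trans m'.2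
  constructor
  · rintro ⟨-, π, hπ⟩
    -- Uniformization constant: it bounds all exit rates, so 1 + Q/Λ is stochastic. The summand 1
    -- keeps it positive even without transitions.
    set Λ : ℝ := 1 + ∑ t, rate t with hΛ
    have hΛ0 : 0 < Λ := by
      have := Finset.sum_nonneg fun t (_ : t ∈ Finset.univ) => (hrate t).le
      positivity
    have hexit : ∀ m, N.exitRate rate m ≤ Λ := fun m => by
      linarith [N.exitRate_le hrate m]
    have hx₀ : ∃ x₀, 0 < π x₀ := by
      by_contra! h
      have : π = 0 := funext fun x => le_antisymm (h x) (hπ.nonneg x)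
      exact zero_ne_one (hasSum_zero.unique (this ▸ hπ.total))
    obtain ⟨x₀, hx₀⟩ := hx₀
    have hjump : ∀ x y : N.State m₀, N.jumpRate rate x y / Λ ≤
        (if x = y then 1 else 0) + N.generator rate x y / Λ := by
      intro x y
      rw [N.generator_eq]
      by_cases h : x = y
      · subst h
        have := (div_le_one hΛ0).2 (hexit x)
        simp only [if_true, sub_div]
        linarith
      · simp [h, Subtype.val_injective.ne h]
    refine summable_of_invariant_of_stationary (π := π)
      (K := fun x y : N.State m₀ => (if x = y then 1 else 0) + N.generator rate x y / Λ)
      (fun x y => (div_nonneg (N.jumpRate_nonneg hrate _ _) hΛ0.le).trans (hjump x y))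
      (fun x => ?_) (fun x y => ?_) hπ.nonneg hπ.total.summable
      (fun y => (hasSum_mul_generator_iff hΛ0).1 (hπ.invariant y)) (fun x => (hν x).le)
      (fun y => (hasSum_mul_generator_iff hΛ0).1 (hinv y)) hx₀
    · have h1 : HasSum (fun y => if x = y then (1 : ℝ) else 0) 1 := by
        convert hasSum_single x fun y hy => ?_ using 1
        · simp
        · simp [hy.symm]
      have h2 : HasSum (fun y : N.State m₀ => N.generator rate x y) 0 := by
        have h3 : HasSum (fun y : N.State m₀ => if (x : P → ℕ) = y then N.exitRate rate x else 0)
            (N.exitRate rate x) := by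
          convert hasSum_single x fun y hy => ?_ using 1
          · simp
          · exact if_neg fun h => hy (Subtype.ext h.symm)
        have h4 := N.hasSum_jumpRate rate (X := N.State m₀) (m := (x : P → ℕ))
          Subtype.val_injective fun t m' hf => ⟨⟨m', x.2.trans hf.reachable⟩, rfl⟩
        simp only [N.generator_eq]
        simpa using h4.sub h3
      simpa using h1.add (h2.div_const Λ)
    · have key : ∀ (a : P → ℕ) (ha : N.Reachable m₀ a) (b : P → ℕ) (hab : N.Reachable a b),
          Relation.ReflTransGen (fun x y : N.State m₀ =>
            0 < (if x = y then 1 else 0) + N.generator rate x y / Λ) ⟨a, ha⟩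
              ⟨b, ha.trans hab⟩ := by
        intro a ha b hab
        induction hab with
        | refl => exact .refl
        | tail hab h ih =>
          obtain ⟨t, ht⟩ := h
          refine ih.tail ?_
          exact (div_pos (N.jumpRate_pos hrate ht) hΛ0).trans_le (hjump ⟨_, _⟩ ⟨_, _⟩)
      exact key x x.2 y (hirr x y)
  · intro hs
    refine ⟨hirr, fun m => ν m / ∑' x : N.State m₀, ν x, ?_, ?_, ?_⟩
    · exact fun m => div_nonneg (hν m).le (tsum_nonneg fun x => (hν x).le)
    · have h0 : 0 < ∑' x : N.State m₀, ν x :=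
        hs.tsum_pos (fun x => (hν x).le) ⟨m₀, Reachable.refl N m₀⟩ (hν _)
      simpa [h0.ne'] using hs.hasSum.div_const (∑' x : N.State m₀, ν x)
    · intro m'
      simpa [div_mul_eq_mul_div] using (hinv m').div_const (∑' x : N.State m₀, ν x)

/-- Balance equations of the bags, for the ratios of visits and firing rates. -/
theorem IsVisit.sum_eq (hN : N.WeaklyReversible) (hrate : ∀ t, 0 < rate t)
    {vis : (P → ℕ) → ℝ} (hvis : N.IsVisit rate vis) {b : P → ℕ} (hb : b ∈ N.bags) :
    open Classical in
    ∑ t with N.post t = b, rate t * (vis (N.pre t) / N.bagRate rate (N.pre t)) =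
      vis b / N.bagRate rate b * ∑ t with N.pre t = b, rate t := by
  classical
  have h0 := (N.bagRate_pos hrate (hN.exists_pre_eq hb)).ne'
  have h1 : vis b / N.bagRate rate b * ∑ t with N.pre t = b, rate t = vis b :=
    div_mul_cancel₀ _ h0
  rw [h1, ← hvis.2 b hb]
  have h2 : ∀ b' ∈ N.bags, vis b' * N.routing rate b' b =
      ∑ t with N.post t = b ∧ N.pre t = b',
        rate t * (vis (N.pre t) / N.bagRate rate (N.pre t)) := by
    intro b' _
    rw [routing, Finset.mul_sum]
    refine Finset.sum_congr (by ext; simp [and_comm]) fun t ht => ?_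
    rw [(Finset.mem_filter.1 ht).2.2]
    ring
  rw [Finset.sum_congr rfl h2]
  simp only [← Finset.filter_filter]
  exact (Finset.sum_fiberwise_of_maps_to (fun t _ => N.pre_mem_bags t) _).symm

/-- Inflow into a marking is grouped by output bag and outflow by input bag; the two balance for
each bag contained in the marking separately. Weak reversibility ensures that all predecessors of a
state are states. -/
theorem hasSum_mul_generator_of_balance (hN : N.WeaklyReversible) {g : (P → ℕ) → ℝ}
    (hg : ∀ b ∈ N.bags, 0 < g b)
    (hbal : open Classical in ∀ b ∈ N.bags, ∑ t with N.post t = b, rate t * g (N.pre t) =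
      g b * ∑ t with N.pre t = b, rate t)
    {ν : (P → ℕ) → ℝ}
    (hν : ∀ t u, ν (u + N.pre t) * g (N.post t) = ν (u + N.post t) * g (N.pre t))
    {m₀ : P → ℕ} (m' : N.State m₀) :
    HasSum (fun m : N.State m₀ => ν m * N.generator rate m m') 0 := by
  classical
  have h1 : HasSum (fun m : N.State m₀ => ν m * if (m : P → ℕ) = m' then N.exitRate rate m else 0)
      (ν m' * N.exitRate rate m') := by
    convert hasSum_single m' fun m hm => ?_ using 1
    · simp
    · rw [if_neg fun h => hm (Subtype.ext h), mul_zero]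
  have h2 := N.hasSum_mul_jumpRate rate (X := N.State m₀) (m' := (m' : P → ℕ))
    Subtype.val_injective (fun t m hf =>
      ⟨⟨m, m'.2.trans (hN.reachable_symm hf.reachable)⟩, rfl⟩) ν
  have h3 : ∑ t with N.post t ≤ (m' : P → ℕ), ν (m' - N.post t + N.pre t) * rate t =
      ν m' * N.exitRate rate m' := by
    have hfib : ∀ (f : T → P → ℕ), (∀ t, f t ∈ N.bags) → ∀ F : T → ℝ,
        ∑ t with f t ≤ (m' : P → ℕ), F t =
          ∑ b ∈ N.bags with b ≤ (m' : P → ℕ), ∑ t with f t = b, F t := by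
      intro f hf F
      rw [← Finset.sum_fiberwise_of_maps_to (g := f) (t := {b ∈ N.bags | b ≤ (m' : P → ℕ)})
        fun t ht => by simpa [hf t] using ht]
      refine Finset.sum_congr rfl fun b hb => Finset.sum_congr ?_ fun _ _ => rfl
      rw [Finset.filter_filter]
      refine Finset.filter_congr fun t _ => ⟨fun h => h.2, fun h => ⟨?_, h⟩⟩
      exact h ▸ (Finset.mem_filter.1 hb).2
    rw [exitRate, hfib _ N.post_mem_bags]
    have hen : ∑ t with N.Enabled t (m' : P → ℕ), rate t =
        ∑ t with N.pre t ≤ (m' : P → ℕ), rate t := rfl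
    rw [hen, hfib _ N.pre_mem_bags, Finset.mul_sum]
    refine Finset.sum_congr rfl fun b hb => ?_
    obtain ⟨hb, hbm⟩ := Finset.mem_filter.1 hb
    have hgb := (hg b hb).ne'
    rw [← mul_right_inj' hgb, mul_left_comm, ← hbal b hb, Finset.mul_sum, Finset.mul_sum]
    refine Finset.sum_congr rfl fun t ht => ?_
    obtain rfl := (Finset.mem_filter.1 ht).2
    have := hν t (m' - N.post t)
    rw [tsub_add_cancel_of_le hbm] at this
    linear_combination rate t * this
  simpa [N.generator_eq, mul_sub, h3] using h2.sub h1

end PetriNet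

/-! ### Left fixed vectors of stochastic matrices and visit ratios. -/

section Stationary

variable {V : Type*} [Fintype V] {A : V → V → ℝ}

/-- A stochastic matrix has a nonzero nonnegative left fixed vector. -/
theorem exists_nonneg_stationary [Nonempty V] (hA : ∀ x y, 0 ≤ A x y)
    (hA1 : ∀ x, ∑ y, A x y = 1) :
    ∃ v : V → ℝ, (∀ x, 0 ≤ v x) ∧ v ≠ 0 ∧ ∀ y, ∑ x, v x * A x y = v y := by
  classical
  have h1 : (Matrix.of A - (1 : Matrix V V ℝ)).mulVec (1 : V → ℝ) = 0 := by
    rw [Matrix.sub_mulVec, Matrix.one_mulVec, sub_eq_zero]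
    funext x
    simp [Matrix.mulVec, dotProduct, hA1]
  obtain ⟨w, hw0, hw⟩ := Matrix.exists_vecMul_eq_zero_iff.2
    (Matrix.exists_mulVec_eq_zero_iff.1 ⟨1, one_ne_zero, h1⟩)
  rw [Matrix.vecMul_sub, Matrix.vecMul_one, sub_eq_zero] at hw
  have hw' : ∀ y, ∑ x, w x * A x y = w y := congrFun hw
  -- The triangle inequality gives |w| ≤ |w|A entrywise. Both sides have the same sum, so |w| is
  -- fixed as well.
  have hle : ∀ y ∈ Finset.univ, |w y| ≤ ∑ x, |w x| * A x y := fun y _ => by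
    rw [← hw' y]
    refine (Finset.abs_sum_le_sum_abs _ _).trans_eq (Finset.sum_congr rfl fun x _ => ?_)
    rw [abs_mul, abs_of_nonneg (hA x y)]
  have hsum : ∑ y, |w y| = ∑ y, ∑ x, |w x| * A x y := by
    rw [Finset.sum_comm]
    simp [← Finset.mul_sum, hA1]
  refine ⟨fun x => |w x|, fun x => abs_nonneg _, fun h => hw0 ?_, fun y => ?_⟩
  · funext x
    simpa using congrFun h x
  · exact ((Finset.sum_eq_sum_iff_of_le hle).1 hsum y (Finset.mem_univ y)).symm

/-- A stochastic matrix all of whose states are recurrent has a positive left fixed vector. -/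
theorem exists_pos_stationary (hA : ∀ x y, 0 ≤ A x y) (hA1 : ∀ x, ∑ y, A x y = 1)
    (hrev : ∀ x y, 0 < A x y → Relation.ReflTransGen (fun x y => 0 < A x y) y x) :
    ∃ v : V → ℝ, (∀ x, 0 < v x) ∧ ∀ y, ∑ x, v x * A x y = v y := by
  classical
  have key : ∀ x₀ : V, ∃ v : V → ℝ, (∀ x, 0 ≤ v x) ∧ 0 < v x₀ ∧
      ∀ y, ∑ x, v x * A x y = v y := by
    intro x₀
    have : Nonempty V := ⟨x₀⟩
    set C : Set V := {x | Relation.ReflTransGen (fun x y => 0 < A x y) x₀ x} with hC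
    have hx₀ : x₀ ∈ C := .refl
    -- Rows outside the class `C` of `x₀` are redirected to `x₀`, which forces the fixed vector to
    -- vanish off `C`; it is then fixed by `A` itself.
    obtain ⟨v, hv0, hv, hvA⟩ := exists_nonneg_stationary
      (A := fun x y => if x ∈ C then A x y else if y = x₀ then 1 else 0)
      (fun x y => by split_ifs <;> simp [hA]) (fun x => by by_cases h : x ∈ C <;> simp [h, hA1])
    have hvC : ∀ y, y ∉ C → v y = 0 := by
      intro y hy
      rw [← hvA y]
      refine Finset.sum_eq_zero fun x _ => ?_
      by_cases hx : x ∈ C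
      · have : A x y = 0 := le_antisymm
          (not_lt.1 fun h => hy (Relation.ReflTransGen.tail hx h)) (hA x y)
        simp [hx, this]
      · have : y ≠ x₀ := fun h => hy (h ▸ hx₀)
        simp [hx, this]
    have hvA' : ∀ y, ∑ x, v x * A x y = v y := by
      intro y
      rw [← hvA y]
      refine Finset.sum_congr rfl fun x _ => ?_
      by_cases hx : x ∈ C
      · simp [hx]
      · simp [hvC x hx]
    have hpos : ∀ x y, Relation.ReflTransGen (fun x y => 0 < A x y) x y → 0 < v x → 0 < v y := by
      intro x y h hx
      induction h with
      | refl => exact hx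
      | @tail y z _ h ih =>
        rw [← hvA' z]
        exact (mul_pos ih h).trans_le (Finset.single_le_sum (f := fun x => v x * A x z)
          (fun x _ => mul_nonneg (hv0 x) (hA x z)) (Finset.mem_univ y))
    obtain ⟨x, hx⟩ := Function.ne_iff.1 hv
    have hxC : x ∈ C := by
      by_contra h
      exact hx (hvC x h)
    have hback : Relation.ReflTransGen (fun x y => 0 < A x y) x x₀ := by
      have : ∀ y, Relation.ReflTransGen (fun x y => 0 < A x y) x₀ y →
          Relation.ReflTransGen (fun x y => 0 < A x y) y x₀ := by
        intro y h
        induction h with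
        | refl => exact .refl
        | tail _ h ih => exact (hrev _ _ h).trans ih
      exact this x hxC
    exact ⟨v, hv0, hpos x x₀ hback ((hv0 x).lt_of_ne' hx), hvA'⟩
  choose v hv0 hv hvA using key
  refine ⟨fun x => ∑ x₀, v x₀ x, fun x => ?_, fun y => ?_⟩
  · exact (hv x).trans_le (Finset.single_le_sum (f := fun x₀ => v x₀ x) (fun x₀ _ => hv0 x₀ x)
      (Finset.mem_univ x))
  · simp only [Finset.sum_mul]
    rw [Finset.sum_comm]
    exact Finset.sum_congr rfl fun x₀ _ => hvA x₀ y

end Stationary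

namespace PetriNet

variable {P T : Type*} [Fintype T] {N : PetriNet P T} {rate : T → ℝ}

theorem routing_nonneg (hrate : ∀ t, 0 < rate t) (b b' : P → ℕ) : 0 ≤ N.routing rate b b' :=
  Finset.sum_nonneg fun t _ =>
    div_nonneg (hrate t).le (Finset.sum_nonneg fun t _ => (hrate t).le)

theorem routing_pos_iff (hrate : ∀ t, 0 < rate t) {b b' : P → ℕ} :
    0 < N.routing rate b b' ↔ N.BagEdge b b' := by
  classical
  constructor
  · intro h
    obtain ⟨t, ht, -⟩ := Finset.exists_ne_zero_of_sum_ne_zero h.ne'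
    exact ⟨t, (Finset.mem_filter.1 ht).2⟩
  · rintro ⟨t, ht⟩
    exact Finset.sum_pos (fun t' _ => div_pos (hrate t') (N.bagRate_pos hrate ⟨t, ht.1⟩))
      ⟨t, by simpa using ht⟩

theorem WeaklyReversible.exists_isVisit (hN : N.WeaklyReversible) (hrate : ∀ t, 0 < rate t) :
    ∃ vis, N.IsVisit rate vis := by
  classical
  have hrow : ∀ b : N.bags, ∑ b' : N.bags, N.routing rate b b' = 1 := by
    rintro ⟨b, hb⟩
    have h0 := (N.bagRate_pos hrate (hN.exists_pre_eq hb)).ne'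
    have h : ∑ b' : N.bags, N.routing rate b b' =
        ∑ b' ∈ N.bags, ∑ t with N.pre t = b ∧ N.post t = b', rate t / N.bagRate rate b :=
      Finset.sum_coe_sort N.bags fun b' => N.routing rate b b'
    simp only [← Finset.filter_filter] at h
    rw [h, Finset.sum_fiberwise_of_maps_to (fun t _ => N.post_mem_bags t), ← Finset.sum_div]
    exact div_self h0
  have hedge : ∀ b b' : P → ℕ, Relation.ReflTransGen N.BagEdge b b' → ∀ (hb : b ∈ N.bags),
      ∃ hb' : b' ∈ N.bags, Relation.ReflTransGen
        (fun x y : N.bags => 0 < N.routing rate x y) ⟨b, hb⟩ ⟨b', hb'⟩ := by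
    intro b b' h hb
    induction h with
    | refl => exact ⟨hb, .refl⟩
    | tail _ h ih =>
      obtain ⟨hc, hr⟩ := ih
      obtain ⟨t, rfl, rfl⟩ := h
      exact ⟨N.post_mem_bags t, hr.tail ((routing_pos_iff hrate).2 ⟨t, rfl, rfl⟩)⟩
  obtain ⟨v, hv, hvA⟩ := exists_pos_stationary
    (A := fun b b' : N.bags => N.routing rate b b') (fun _ _ => routing_nonneg hrate _ _) hrow
    (fun b b' h => by
      obtain ⟨t, hb, hb'⟩ := (routing_pos_iff hrate).1 h
      have h1 : Relation.ReflTransGen N.BagEdge (b' : P → ℕ) b := hb ▸ hb' ▸ hN t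
      exact (hedge _ _ h1 b'.2).2)
  refine ⟨fun b => if h : b ∈ N.bags then v ⟨b, h⟩ else 0, fun b hb => by simp [hb, hv],
    fun b hb => ?_⟩
  have := hvA ⟨b, hb⟩
  rw [← Finset.sum_coe_sort]
  simpa [hb] using this

variable [Fintype P]

theorem IsProductForm.pos (hN : N.WeaklyReversible) (hrate : ∀ t, 0 < rate t) {μ : P → ℝ}
    (hμ : N.IsProductForm rate μ) (p : P) : 0 < μ p := by
  obtain ⟨wit, vis, -, hvis, hμ⟩ := hμ
  rw [hμ p]
  exact Finset.prod_pos fun b hb => Real.rpow_pos_of_pos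
    (div_pos (hvis.1 b hb) (N.bagRate_pos hrate (hN.exists_pre_eq hb))) _

/-- The product-form measure of a marking, for the logarithms `ℓ` of the product-form constants. -/
noncomputable def productMeasure (ℓ : P → ℝ) (m : P → ℕ) : ℝ := Real.exp (∑ p, m p * ℓ p)

theorem productMeasure_add (ℓ : P → ℝ) (m m' : P → ℕ) :
    productMeasure ℓ (m + m') = productMeasure ℓ m * productMeasure ℓ m' := by
  simp [productMeasure, ← Real.exp_add, ← Finset.sum_add_distrib, add_mul]

/-- Pairing a firing with log μ gives log g(post) - log g(pre), where g = vis / rate of the bag. So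
the measure of u + b divided by g(b) is the same at both ends of a transition, and the visit
equations are the required balance of g. -/
theorem IsProductForm.isErgodic_iff_summable (hN : N.WeaklyReversible) (hrate : ∀ t, 0 < rate t)
    {μ : P → ℝ} (hμ : N.IsProductForm rate μ) (m₀ : P → ℕ) :
    N.IsErgodic rate m₀ ↔
      Summable fun m : N.State m₀ => productMeasure (fun p => Real.log (μ p)) m := by
  classical
  obtain ⟨wit, vis, hwit, hvis, hμ⟩ := hμ
  set g : (P → ℕ) → ℝ := fun b => vis b / N.bagRate rate b with hgdef
  have hg : ∀ b ∈ N.bags, 0 < g b := fun b hb =>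
    div_pos (hvis.1 b hb) (N.bagRate_pos hrate (hN.exists_pre_eq hb))
  have hlog : ∀ p, Real.log (μ p) = ∑ b ∈ N.bags, (wit b p : ℝ) * Real.log (g b) := fun p => by
    rw [hμ p, Real.log_prod fun b hb => (Real.rpow_pos_of_pos (hg b hb) _).ne']
    exact Finset.sum_congr rfl fun b hb => Real.log_rpow (hg b hb) _
  have hdiff : ∀ t, ∑ p, ((N.post t p : ℝ) - N.pre t p) * Real.log (μ p) =
      Real.log (g (N.post t)) - Real.log (g (N.pre t)) := by
    intro t
    have h1 : ∀ b ∈ N.bags, ∑ p, (wit b p : ℝ) * ((N.post t p : ℝ) - N.pre t p) =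
        (if N.post t = b then 1 else 0) - (if N.pre t = b then 1 else 0) := by
      intro b hb
      have := congrArg (Rat.cast (K := ℝ)) (hwit b hb t)
      push_cast at this
      rw [this]
      by_cases h : N.pre t = b
      · have : N.post t ≠ b := fun h' => N.pre_ne_post t (h.trans h'.symm)
        simp [h, this]
      · by_cases h' : N.post t = b <;> simp [h, h']
    calc ∑ p, ((N.post t p : ℝ) - N.pre t p) * Real.log (μ p)
        = ∑ b ∈ N.bags, (∑ p, (wit b p : ℝ) * ((N.post t p : ℝ) - N.pre t p)) * Real.log (g b) := by
          simp only [hlog, Finset.mul_sum, Finset.sum_mul]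
          rw [Finset.sum_comm]
          refine Finset.sum_congr rfl fun b _ => Finset.sum_congr rfl fun p _ => ?_
          ring
      _ = ∑ b ∈ N.bags, ((if N.post t = b then 1 else 0) - (if N.pre t = b then 1 else 0)) *
            Real.log (g b) := Finset.sum_congr rfl fun b hb => by rw [h1 b hb]
      _ = _ := by simp [sub_mul, Finset.sum_sub_distrib, N.post_mem_bags, N.pre_mem_bags]
  refine hN.isErgodic_iff_summable hrate (fun m => Real.exp_pos _)
    (hasSum_mul_generator_of_balance hN hg (fun b hb => hvis.sum_eq hN hrate hb) ?_)
  intro t u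
  have hpost := hg _ (N.post_mem_bags t)
  have hpre := hg _ (N.pre_mem_bags t)
  rw [productMeasure_add, productMeasure_add, mul_assoc, mul_assoc]
  congr 1
  rw [← Real.exp_log hpost, ← Real.exp_log hpre, productMeasure, productMeasure, ← Real.exp_add,
    ← Real.exp_add]
  congr 1
  have := hdiff t
  simp only [sub_mul, Finset.sum_sub_distrib] at this
  linarith

end PetriNet

/-! ### Bags, layers and resources of an open net. -/

namespace OpenPi3

variable {P T : Type*} [Fintype P] [Fintype T] {N : PetriNet P T} {n : ℕ} (S : OpenPi3 N n)

/-- The bag of a place of the closed net, in which `p_ext` has been deleted. -/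
def openBag (x : Option P) : P → ℕ := fun p => S.pi3.bag x (some p)

open Classical in
/-- The marking with a single token in `x`, and the empty marking for `x = p_ext`. -/
noncomputable def token (x : Option P) : P → ℕ := fun p => if some p = x then 1 else 0

open Classical in
/-- The number of tokens in the places of maximal potential of a layer. -/
noncomputable def mass (j : ℕ) (m : P → ℕ) : ℕ := ∑ p with p ∈ S.maxPlaces j, m p

theorem layer_pos (x : Option P) : 1 ≤ S.pi3.layer x := (S.pi3.layer_mem x).1

theorem layer_le (x : Option P) : S.pi3.layer x ≤ n := (S.pi3.layer_mem x).2

theorem layer_of_mem_maxPlaces {p : P} {j : ℕ} (h : p ∈ S.maxPlaces j) :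
    S.pi3.layer (some p) = j := h.1

theorem exists_transition (t : T) : ∃ y z, S.pi3.layer y = S.pi3.layer z ∧
    S.closedNet.pre t = S.pi3.bag y ∧ S.closedNet.post t = S.pi3.bag z ∧
    N.pre t = S.openBag y ∧ N.post t = S.openBag z := by
  obtain ⟨y, -, hy⟩ := S.pi3.bag_bijOn.surjOn (S.closedNet.pre_mem_bags t)
  obtain ⟨z, -, hz⟩ := S.pi3.bag_bijOn.surjOn (S.closedNet.post_mem_bags t)
  refine ⟨y, z, ?_, hy.symm, hz.symm, ?_, ?_⟩
  · exact (S.pi3.layer_eq_iff y z).2 (.single ⟨t, hy.symm, hz.symm⟩)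
  · funext p
    rw [S.pre_eq, ← hy, openBag]
  · funext p
    rw [S.post_eq, ← hz, openBag]

theorem exists_transition_of_place (x : Option P) : ∃ t y, S.pi3.layer y = S.pi3.layer x ∧
    N.pre t = S.openBag y := by
  have hx := S.pi3.bag_bijOn.mapsTo (Set.mem_univ x)
  simp only [PetriNet.bags, Finset.coe_union, Finset.coe_image, Finset.coe_univ,
    Set.image_univ, Set.mem_union, Set.mem_range] at hx
  obtain ⟨t, ht⟩ | ⟨t, ht⟩ := hx <;> obtain ⟨y, z, h, hy, hz, hy', -⟩ := S.exists_transition t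
  · exact ⟨t, y, congrArg _ (S.pi3.bag_bijOn.injOn (Set.mem_univ _) (Set.mem_univ _)
      (hy.symm.trans ht)), hy'⟩
  · refine ⟨t, y, h.trans (congrArg _ ?_), hy'⟩
    exact S.pi3.bag_bijOn.injOn (Set.mem_univ _) (Set.mem_univ _) (hz.symm.trans ht)

/-- Deleting a coordinate maps paths of the closed bag graph to paths of the open one. -/
theorem bagPath {x y : Option P} (h : S.pi3.layer x = S.pi3.layer y) :
    Relation.ReflTransGen N.BagEdge (S.openBag x) (S.openBag y) := by
  refine ((S.pi3.layer_eq_iff x y).1 h).lift (fun b p => b (some p)) ?_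
  rintro _ _ ⟨t, rfl, rfl⟩
  exact ⟨t, funext (S.pre_eq t), funext (S.post_eq t)⟩

theorem weaklyReversible (S : OpenPi3 N n) : N.WeaklyReversible := by
  intro t
  obtain ⟨y, z, h, -, -, hy, hz⟩ := S.exists_transition t
  rw [hy, hz]
  exact S.bagPath h.symm

theorem layer_of_bag_pos {x q : Option P} (hq : q ≠ x) (h : 0 < S.pi3.bag x q) :
    S.pi3.layer q + 1 = S.pi3.layer x := by
  have h1 : S.pi3.layer q = S.pi3.layer x - 1 := (S.pi3.resource x q hq h).1
  have h2 := S.layer_pos x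
  omega

theorem openBag_eq_token {x : Option P} {p : P} (hp : p ∉ S.maxPlaces (S.pi3.layer x - 1)) :
    S.openBag x p = token x p := by
  by_cases h : some p = x
  · subst h
    simp [openBag, token, S.pi3.bag_self]
  · rw [token, if_neg h]
    by_contra h0
    exact hp (S.pi3.resource x _ h (Nat.pos_of_ne_zero h0))

theorem token_of_layer_ne {x : Option P} {p : P} (h : S.pi3.layer (some p) ≠ S.pi3.layer x) :
    token x p = 0 :=
  if_neg fun h' => h (congrArg _ h')

theorem mass_add (j : ℕ) (m m' : P → ℕ) : S.mass j (m + m') = S.mass j m + S.mass j m' := by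
  simp [mass, Finset.sum_add_distrib]

theorem mass_congr {j : ℕ} {m m' : P → ℕ} (h : ∀ p ∈ S.maxPlaces j, m p = m' p) :
    S.mass j m = S.mass j m' :=
  Finset.sum_congr rfl fun p hp => h p (by simpa using hp)

theorem mass_token_of_layer_ne {j : ℕ} {x : Option P} (h : S.pi3.layer x ≠ j) :
    S.mass j (token x) = 0 := by
  classical
  refine Finset.sum_eq_zero fun p hp => S.token_of_layer_ne ?_
  rw [S.layer_of_mem_maxPlaces (Finset.mem_filter.1 hp).2]
  exact h.symm

theorem mass_token {j : ℕ} {p : P} (h : p ∈ S.maxPlaces j) : S.mass j (token (some p)) = 1 := by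
  classical
  rw [mass, Finset.sum_eq_single_of_mem p (by simpa using h) fun q _ hq => ?_] <;> simp_all [token]

/-- All tokens of a bag except the one in its own place are resources from the preceding layer. The
deleted place lies in the last layer, so it is never a resource and its deletion loses none of them.
-/
theorem mass_openBag (x : Option P) :
    S.mass (S.pi3.layer x - 1) (S.openBag x) = potential S.pi3.bag x := by
  classical
  have hx := S.layer_pos x
  have h : ∀ q, S.pi3.bag x q = (if q = x then 1 else 0) +
      if q ∈ _root_.maxPlaces S.pi3.layer S.pi3.bag (S.pi3.layer x - 1)
        then S.pi3.bag x q else 0 := by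
    intro q
    by_cases hq : q = x
    · subst hq
      have : q ∉ _root_.maxPlaces S.pi3.layer S.pi3.bag (S.pi3.layer q - 1) := fun h => by
        have : S.pi3.layer q = S.pi3.layer q - 1 := h.1
        omega
      simp [this, S.pi3.bag_self]
    · by_cases hb : S.pi3.bag x q = 0
      · simp [hb, hq]
      · simp [hq, S.pi3.resource x q hq (Nat.pos_of_ne_zero hb)]
  have hnone : none ∉ _root_.maxPlaces S.pi3.layer S.pi3.bag (S.pi3.layer x - 1) := fun h => by
    have h1 : S.pi3.layer none = S.pi3.layer x - 1 := h.1
    have h2 := S.layer_le x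
    rw [S.layer_ext] at h1
    omega
  rw [potential, Finset.sum_congr rfl fun q _ => h q, Finset.sum_add_distrib,
    Fintype.sum_option (fun q => if q ∈ _ then S.pi3.bag x q else 0)]
  simp [hnone, mass, maxPlaces, openBag, ← Finset.sum_filter]
  congr!

/-! ### Existence of witnesses. -/

section Witness

/-- The square matrix of the bags of the closed net. -/
def bagMatrix : Matrix (Option P) (Option P) ℚ := Matrix.of fun x y => (S.pi3.bag x y : ℚ)

/-- Ordered by layers, the matrix is unitriangular: a kernel vector vanishes by induction on the
layer. -/
theorem isUnit_bagMatrix [DecidableEq P] : IsUnit S.bagMatrix := by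
  rw [← Matrix.mulVec_injective_iff_isUnit]
  refine (injective_iff_map_eq_zero S.bagMatrix.mulVecLin).2 fun v hv => ?_
  have key : ∀ k x, S.pi3.layer x = k → v x = 0 := by
    intro k
    induction k using Nat.strong_induction_on with
    | _ k ih =>
      rintro x rfl
      have h := congrFun hv x
      simp only [Matrix.mulVecLin_apply, Matrix.mulVec, dotProduct, bagMatrix, Matrix.of_apply,
        Pi.zero_apply] at h
      rw [Finset.sum_eq_single x] at h
      · simpa [S.pi3.bag_self] using h
      · intro q _ hq
        by_cases hb : S.pi3.bag x q = 0
        · simp [hb]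
        · rw [ih _ _ q rfl, mul_zero]
          have := S.layer_of_bag_pos hq (Nat.pos_of_ne_zero hb)
          omega
      · simp
  exact funext fun x => key _ x rfl

theorem sum_layer_eq (z : Option P) :
    ∑ q, (if S.pi3.layer q = n then (S.pi3.bag z q : ℚ) else 0) =
      if S.pi3.layer z = n then 1 else 0 := by
  rw [Finset.sum_eq_single z]
  · simp [S.pi3.bag_self]
  · intro q _ hq
    by_cases hb : S.pi3.bag z q = 0
    · simp [hb]
    · have h1 := S.layer_of_bag_pos hq (Nat.pos_of_ne_zero hb)
      have h2 := S.layer_le z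
      rw [if_neg (by omega)]
  · simp

/-- Linear functionals that separate the bags of the closed net, up to a constant on each layer,
and do not depend on `p_ext`. -/
theorem exists_dual (x : Option P) [DecidableEq P] : ∃ c : P → ℚ, ∀ y z,
    S.pi3.layer y = S.pi3.layer z →
    ∑ p, c p * ((S.openBag z p : ℚ) - S.openBag y p) =
      (if z = x then 1 else 0) - if y = x then 1 else 0 := by
  set C := S.bagMatrix⁻¹ with hC
  have hBC : S.bagMatrix * C = 1 :=
    Matrix.mul_nonsing_inv _ ((Matrix.isUnit_iff_isUnit_det _).1 S.isUnit_bagMatrix)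
  have hz : ∀ z, ∑ q, (S.pi3.bag z q : ℚ) * C q x = if z = x then 1 else 0 := by
    intro z
    simpa [Matrix.mul_apply, bagMatrix, Matrix.one_apply] using congrFun (congrFun hBC z) x
  -- A column of the inverse matrix separates the bag of `x`. Subtracting a multiple of the token
  -- count of layer `n`, which is constant on the bags of each layer, removes its coefficient at
  -- `none`.
  set c : Option P → ℚ := fun q => C q x - C none x * if S.pi3.layer q = n then 1 else 0 with hc
  have hc0 : c none = 0 := by simp [hc, S.layer_ext]
  have hcz : ∀ z, ∑ p, c (some p) * (S.openBag z p : ℚ) =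
      (if z = x then 1 else 0) - C none x * if S.pi3.layer z = n then 1 else 0 := by
    intro z
    have h1 : ∑ q, c q * (S.pi3.bag z q : ℚ) =
        (if z = x then 1 else 0) - C none x * if S.pi3.layer z = n then 1 else 0 := by
      rw [← hz, ← S.sum_layer_eq, Finset.mul_sum, ← Finset.sum_sub_distrib]
      refine Finset.sum_congr rfl fun q _ => ?_
      simp only [hc]
      split_ifs <;> ring
    rw [← h1, Fintype.sum_option, hc0, zero_mul, zero_add]
    rfl
  refine ⟨fun p => c (some p), fun y z hyz => ?_⟩
  simp only [mul_sub, Finset.sum_sub_distrib, hcz, hyz]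
  ring

/-- Distinct closed bags may coincide once the extra place is deleted, so the functionals of all
closed bags lying over `b` are added. -/
theorem exists_isWitness (S : OpenPi3 N n) : ∃ wit : (P → ℕ) → P → ℚ, ∀ b, N.IsWitness b (wit b) := by
  classical
  choose c hc using fun x => S.exists_dual x
  refine ⟨fun b p => ∑ x with S.openBag x = b, c x p, fun b t => ?_⟩
  obtain ⟨y, z, h, -, -, hy, hz⟩ := S.exists_transition t
  simp only [Finset.sum_mul]
  rw [Finset.sum_comm, hy, hz, Finset.sum_congr rfl fun x _ => hc x y z h,
    Finset.sum_sub_distrib]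
  have hne : S.openBag y ≠ S.openBag z := hy ▸ hz ▸ N.pre_ne_post t
  simp only [Finset.sum_ite_eq, Finset.mem_filter, Finset.mem_univ, true_and]
  by_cases h1 : S.openBag y = b
  · subst h1
    simp [hne.symm]
  · simp [h1]

end Witness

end OpenPi3

/-! ### Moving tokens when resources suffice. -/

namespace OpenPi3

variable {P T : Type*} [Fintype P] [Fintype T] {N : PetriNet P T} {n : ℕ} (S : OpenPi3 N n)

/-- In each of the first `k` layers, the resources suffice to move a token everywhere. -/
def Good (k : ℕ) (m : P → ℕ) : Prop :=
  ∀ x, S.pi3.layer x ≤ k → potential S.pi3.bag x ≤ S.mass (S.pi3.layer x - 1) m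

variable {S}

theorem Good.mono {k l : ℕ} {m : P → ℕ} (h : S.Good k m) (hl : l ≤ k) : S.Good l m :=
  fun x hx => h x (hx.trans hl)

theorem Good.of_mass_le {k : ℕ} {m m' : P → ℕ} (h : S.Good k m)
    (hm : ∀ j < k, S.mass j m ≤ S.mass j m') : S.Good k m' := fun x hx =>
  (h x hx).trans (hm _ (by have := S.layer_pos x; omega))

theorem Good.add {k : ℕ} {m : P → ℕ} (h : S.Good k m) (u : P → ℕ) : S.Good k (m + u) :=
  h.of_mass_le fun j _ => by rw [S.mass_add]; exact Nat.le_add_right _ _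

variable (S)

theorem notMem_maxPlaces {p : P} {j : ℕ} (h : S.pi3.layer (some p) ≠ j) : p ∉ S.maxPlaces j :=
  fun h' => h h'.1

/-- Tokens can be moved inside `P_k^max` so as to cover a given bag. -/
theorem exists_rearrangement {k : ℕ} {m C : P → ℕ} (hm : S.mass k C ≤ S.mass k m) :
    ∃ u, (∀ p ∉ S.maxPlaces k, u p = m p) ∧ S.mass k (u + C) = S.mass k m := by
  classical
  by_cases h : ∃ r, r ∈ S.maxPlaces k
  · obtain ⟨r, hr⟩ := h
    refine ⟨fun p => if p ∈ S.maxPlaces k then (if p = r then S.mass k m - S.mass k C else 0)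
      else m p, fun p hp => if_neg hp, ?_⟩
    rw [S.mass_add]
    have : S.mass k (fun p => if p ∈ S.maxPlaces k then
        (if p = r then S.mass k m - S.mass k C else 0) else m p) =
          S.mass k m - S.mass k C := by
      rw [mass, Finset.sum_eq_single_of_mem r (by simpa using hr) fun q hq hqr => ?_]
      · simp [hr]
      · simp_all
    omega
  · push Not at h
    refine ⟨m, fun _ _ => rfl, S.mass_congr fun p hp => absurd hp (h p)⟩

/-- Tokens can be moved freely inside `P_k^max`. -/
def Rearranges (k : ℕ) : Prop :=
  ∀ m m' : P → ℕ, S.Good k m → (∀ p ∉ S.maxPlaces k, m p = m' p) → S.mass k m = S.mass k m' →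
    N.Reachable m m'

variable {S}

theorem mass_eq_of_jump {k j : ℕ} (hj : j < k) {x y : Option P} (hx : S.pi3.layer x = k + 1)
    (hy : S.pi3.layer y = k + 1) {m m' : P → ℕ}
    (h : ∀ p ∉ S.maxPlaces k, m' p + token x p = m p + token y p) :
    S.mass j m' = S.mass j m := by
  refine S.mass_congr fun p hp => ?_
  have hp := S.layer_of_mem_maxPlaces hp
  have := h p (S.notMem_maxPlaces (by omega))
  rwa [S.token_of_layer_ne (by omega), S.token_of_layer_ne (by omega)] at this

/-- The resources are first gathered to complete the bag of `x`, and a path of bags then turns it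
into the bag of `y`. The resources change by the difference of potentials. -/
theorem exists_jump {k : ℕ} (hk : S.Rearranges k) {x y : Option P} (hx : S.pi3.layer x = k + 1)
    (hy : S.pi3.layer y = k + 1) {m : P → ℕ} (hm : S.Good k m) (hxm : token x ≤ m)
    (hpot : potential S.pi3.bag x ≤ S.mass k m) :
    ∃ m', N.Reachable m m' ∧ (∀ p ∉ S.maxPlaces k, m' p + token x p = m p + token y p) ∧
      S.mass k m' + potential S.pi3.bag x = S.mass k m + potential S.pi3.bag y := by
  classical
  have hbx := S.mass_openBag x
  have hby := S.mass_openBag y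
  rw [hx, Nat.add_sub_cancel] at hbx
  rw [hy, Nat.add_sub_cancel] at hby
  have htx : ∀ p ∈ S.maxPlaces k, token x p = 0 := fun p hp => S.token_of_layer_ne (by
    rw [S.layer_of_mem_maxPlaces hp]; omega)
  have hox : ∀ p ∉ S.maxPlaces k, S.openBag x p = token x p := fun p hp =>
    S.openBag_eq_token (by simpa [hx] using hp)
  have hoy : ∀ p ∉ S.maxPlaces k, S.openBag y p = token y p := fun p hp =>
    S.openBag_eq_token (by simpa [hy] using hp)
  set C : P → ℕ := fun p => if p ∈ S.maxPlaces k then S.openBag x p else 0 with hC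
  have hmC : S.mass k C = potential S.pi3.bag x := by
    rw [← hbx]
    exact S.mass_congr fun p hp => by simp [hC, hp]
  obtain ⟨u, hu, hmu⟩ := S.exists_rearrangement (k := k) (C := C) (m := m)
    (hmC ▸ hpot)
  have hux : token x ≤ u := by
    intro p
    by_cases hp : p ∈ S.maxPlaces k
    · simp [htx p hp]
    · rw [hu p hp]
      exact hxm p
  obtain ⟨w, rfl⟩ : ∃ w, u = w + token x := ⟨u - token x, (tsub_add_cancel_of_le hux).symm⟩
  have h1 : w + token x + C = w + S.openBag x := by
    rw [add_assoc]
    congr 1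
    funext p
    by_cases hp : p ∈ S.maxPlaces k
    · simp [htx p hp, hC, hp]
    · simp [hox p hp, hC, hp]
  refine ⟨w + S.openBag y, ?_, fun p hp => ?_, ?_⟩
  · have h2 : N.Reachable m (w + token x + C) := by
      refine hk _ _ hm (fun p hp => ?_) hmu.symm
      rw [← hu p hp]
      simp [hC, hp]
    rw [h1] at h2
    exact h2.trans (PetriNet.reachable_of_bagPath (S.bagPath (hx.trans hy.symm)) w)
  · rw [← hu p hp]
    simp only [Pi.add_apply, hoy p hp]
    omega
  · have h3 := S.mass_token_of_layer_ne (j := k) (x := x) (by omega)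
    rw [S.mass_add, S.mass_add, h3, hmC] at hmu
    rw [S.mass_add]
    omega

/-- A jump leaves the lower layers alone, so one more rearrangement yields any prescribed
distribution of the resources. -/
theorem reachable_of_jump {k : ℕ} (hk : S.Rearranges k) {x y : Option P}
    (hx : S.pi3.layer x = k + 1) (hy : S.pi3.layer y = k + 1) {m m' : P → ℕ} (hm : S.Good k m)
    (hxm : token x ≤ m) (hpot : potential S.pi3.bag x ≤ S.mass k m)
    (h : ∀ p ∉ S.maxPlaces k, m' p + token x p = m p + token y p)
    (hmass : S.mass k m' + potential S.pi3.bag x = S.mass k m + potential S.pi3.bag y) :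
    N.Reachable m m' := by
  obtain ⟨m₁, hr, h₁, hmass₁⟩ := exists_jump hk hx hy hm hxm hpot
  refine hr.trans (hk _ _ (hm.of_mass_le fun j hj => (mass_eq_of_jump hj hx hy h₁).ge)
    (fun p hp => ?_) (by omega))
  have := h p hp
  have := h₁ p hp
  omega

variable (S)

/-- Induction on the layer: tokens of layer `k + 1` move by using resources of layer `k`, and since
maximal places have equal potential, such a move costs no resources in total. Each move lowers the
surplus of `m` over `m'`. -/
theorem rearranges (k : ℕ) : S.Rearranges k := by
  classical
  induction k with
  | zero =>
    intro m m' _ h _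
    have : m = m' := funext fun p => h p (S.notMem_maxPlaces (by
      have := S.layer_pos (some p)
      omega))
    exact this ▸ PetriNet.Reachable.refl N m
  | succ k hk =>
    intro m m' hm h hmass
    induction hd : ∑ p, (m p - m' p) using Nat.strong_induction_on generalizing m with
    | _ d ih =>
      by_cases hle : m ≤ m'
      · have : m = m' := by
          funext p
          by_cases hp : p ∈ S.maxPlaces (k + 1)
          · exact (Finset.sum_eq_sum_iff_of_le fun p _ => hle p).1 hmass p (by simpa using hp)
          · exact h p hp
        exact this ▸ PetriNet.Reachable.refl N m
      · obtain ⟨p, hp⟩ := not_forall.1 hle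
        replace hp : m' p < m p := not_le.1 hp
        have hpA : p ∈ S.maxPlaces (k + 1) := by
          by_contra hpA
          exact hp.ne' (h p hpA)
        obtain ⟨q, hqA, hq⟩ : ∃ q ∈ S.maxPlaces (k + 1), m q < m' q := by
          by_contra! hle'
          refine hmass.not_gt (Finset.sum_lt_sum (fun q hq => hle' q ?_) ⟨p, ?_, hp⟩)
          · simpa using hq
          · simpa using hpA
        have hpq : p ≠ q := by
          rintro rfl
          omega
        have hlp := S.layer_of_mem_maxPlaces hpA
        have hlq := S.layer_of_mem_maxPlaces hqA
        have hpot : potential S.pi3.bag (some p) = potential S.pi3.bag (some q) :=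
          le_antisymm (hqA.2 _ hlp) (hpA.2 _ hlq)
        have htp : token (some p) ≤ m := by
          intro r
          by_cases hr : r = p
          · subst hr
            simp only [token, if_true]
            omega
          · simp [token, hr]
        set m₁ := m - token (some p) + token (some q) with hm₁
        have h₁ : ∀ r, m₁ r + token (some p) r = m r + token (some q) r := by
          intro r
          have : token (some p) r ≤ m r := htp r
          simp only [hm₁, Pi.add_apply, Pi.sub_apply]
          omega
        have hmass₁ : ∀ j, S.mass j m₁ + S.mass j (token (some p)) =
            S.mass j m + S.mass j (token (some q)) := by
          intro j
          rw [← S.mass_add, ← S.mass_add]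
          exact congrArg _ (funext h₁)
        have hmass₁' : ∀ j < k + 1, S.mass j m₁ = S.mass j m := by
          intro j hj
          have := hmass₁ j
          rwa [S.mass_token_of_layer_ne (by omega), S.mass_token_of_layer_ne (by omega)] at this
        have hr : N.Reachable m m₁ := by
          refine reachable_of_jump hk hlp hlq (hm.mono k.le_succ) htp ?_ (fun r _ => h₁ r) ?_
          · simpa [hlp] using hm (some p) hlp.le
          · rw [hmass₁' k k.lt_succ_self, hpot]
        refine hr.trans (ih _ ?_ m₁ (hm.of_mass_le fun j hj => (hmass₁' j hj).ge)
          (fun r hr => ?_) ?_ rfl)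
        · rw [← hd]
          refine Finset.sum_lt_sum (fun r _ => ?_) ⟨p, Finset.mem_univ p, ?_⟩
          · have h2 := h₁ r
            by_cases hrq : r = q
            · subst hrq
              simp only [token, if_true, Option.some.injEq, hpq.symm, if_false] at h2
              omega
            · have : token (some q) r = 0 := by simp [token, hrq]
              omega
          · have h2 := h₁ p
            simp only [token, if_true, Option.some.injEq, hpq, if_false] at h2
            omega
        · rw [← h r hr]
          have h2 := h₁ r
          have hrp : r ≠ p := fun h => hr (h ▸ hpA)
          have hrq : r ≠ q := fun h => hr (h ▸ hqA)
          simpa [token, hrp, hrq] using h2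
        · have := hmass₁ (k + 1)
          rw [S.mass_token hpA, S.mass_token hqA] at this
          omega

end OpenPi3

/-! ### Live markings lead to sufficient resources. -/

namespace OpenPi3

variable {P T : Type*} [Fintype P] [Fintype T] {N : PetriNet P T} {n : ℕ} (S : OpenPi3 N n)

theorem token_none {P : Type*} : (token none : P → ℕ) = 0 := by
  funext p
  simp [token]

theorem token_le_openBag (x : Option P) : token x ≤ S.openBag x := by
  intro p
  by_cases h : some p = x
  · subst h
    simp [token, openBag, S.pi3.bag_self]
  · simp [token, h]

theorem token_some_le {P : Type*} {p : P} {m : P → ℕ} (h : 0 < m p) : token (some p) ≤ m := by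
  intro q
  by_cases hq : q = p
  · subst hq
    simp only [token, if_true]
    exact h
  · simp [token, hq]

theorem exists_maxPlace {x : Option P} : ∃ y, S.pi3.layer y = S.pi3.layer x ∧
    ∀ z, S.pi3.layer z = S.pi3.layer x → potential S.pi3.bag z ≤ potential S.pi3.bag y := by
  classical
  obtain ⟨y, hy, h⟩ := Finset.exists_max_image
    (Finset.univ.filter fun y => S.pi3.layer y = S.pi3.layer x) (potential S.pi3.bag)
    ⟨x, by simp⟩
  exact ⟨y, by simpa using hy, fun z hz => h z (by simpa using hz)⟩

open Classical in
/-- The number of tokens in a layer. -/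
noncomputable def layerMass (j : ℕ) (m : P → ℕ) : ℕ :=
  ∑ p with S.pi3.layer (some p) = j, m p

theorem layerMass_add (j : ℕ) (m m' : P → ℕ) :
    S.layerMass j (m + m') = S.layerMass j m + S.layerMass j m' := by
  simp [layerMass, Finset.sum_add_distrib]

theorem mass_le_layerMass (j : ℕ) (m : P → ℕ) : S.mass j m ≤ S.layerMass j m := by
  classical
  refine Finset.sum_le_sum_of_subset fun p hp => ?_
  simpa using S.layer_of_mem_maxPlaces (Finset.mem_filter.1 hp).2

theorem layerMass_openBag {j : ℕ} (hj : j < n) {x : Option P} (hx : S.pi3.layer x ≠ j + 1) :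
    S.layerMass j (S.openBag x) = if S.pi3.layer x = j then 1 else 0 := by
  classical
  split_ifs with h
  · obtain _ | p := x
    · rw [S.layer_ext] at h
      omega
    · rw [layerMass, Finset.sum_eq_single_of_mem p (by simpa using h) fun q hq hqp => ?_]
      · simp [openBag, S.pi3.bag_self]
      · by_contra h0
        have := S.layer_of_bag_pos (x := some p) (q := some q) (by simpa using hqp)
          (Nat.pos_of_ne_zero h0)
        have := (Finset.mem_filter.1 hq).2
        omega
  · refine Finset.sum_eq_zero fun q hq => ?_
    have hq := (Finset.mem_filter.1 hq).2
    by_contra h0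
    by_cases hqx : some q = x
    · subst hqx
      exact h hq
    · have := S.layer_of_bag_pos hqx (Nat.pos_of_ne_zero h0)
      omega

/-- A layer whose tokens and resources cannot interact. -/
def Stuck (k K : ℕ) (m : P → ℕ) : Prop :=
  S.layerMass k m = K ∧ ∀ y, S.pi3.layer y = k + 1 → token y ≤ m → K < potential S.pi3.bag y

variable {S}

theorem Stuck.not_openBag_le {k K : ℕ} {m : P → ℕ} (h : S.Stuck k K m) {y : Option P}
    (hy : S.pi3.layer y = k + 1) : ¬ S.openBag y ≤ m := by
  intro hle
  have h1 := h.2 y hy ((S.token_le_openBag y).trans hle)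
  have h2 := S.mass_openBag y
  rw [hy, Nat.add_sub_cancel] at h2
  have h3 : S.mass k (S.openBag y) ≤ S.mass k m := Finset.sum_le_sum fun p _ => hle p
  have h4 := S.mass_le_layerMass k m
  rw [h.1] at h4
  omega

/-- No transition of layer `k + 1` is enabled, and the others preserve the token count of layer `k`.
New tokens in layer `k + 1` can only be resources released by layer `k + 2`, hence lie in maximal
places, whose potential exceeds `K`. -/
theorem Stuck.fires {k K : ℕ} (hk : k < n)
    (hK : ∀ p ∈ S.maxPlaces (k + 1), K < potential S.pi3.bag (some p))
    (hK' : K < potential S.pi3.bag none ∨ k + 1 ≠ n)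
    {m m' : P → ℕ} (h : S.Stuck k K m) {t : T} (ht : N.Fires t m m') : S.Stuck k K m' := by
  obtain ⟨y, z, hyz, -, -, hy, hz⟩ := S.exists_transition t
  obtain ⟨u, rfl, rfl⟩ := N.fires_iff.1 ht
  rw [hy] at h
  rw [hz]
  have hyk : S.pi3.layer y ≠ k + 1 := fun hyk => h.not_openBag_le hyk le_add_self
  refine ⟨?_, fun x hx hle => ?_⟩
  · have := h.1
    rw [S.layerMass_add, S.layerMass_openBag hk hyk] at this
    rw [S.layerMass_add, S.layerMass_openBag hk (hyz ▸ hyk), ← hyz, this]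
  · obtain _ | p := x
    · rw [S.layer_ext] at hx
      exact hK'.resolve_right fun h => h hx.symm
    · by_cases hp : p ∈ S.maxPlaces (k + 1)
      · exact hK p hp
      · refine h.2 _ hx (token_some_le ?_)
        have h1 : 1 ≤ u p + S.openBag z p := by simpa [token] using hle p
        have h2 : S.openBag z p = 0 := by
          by_contra h0
          by_cases hpz : some p = z
          · subst hpz
            omega
          · have h3 := S.pi3.resource z _ hpz (Nat.pos_of_ne_zero h0)
            have h4 := S.layer_of_bag_pos hpz (Nat.pos_of_ne_zero h0)
            refine hp ?_
            have : S.pi3.layer z - 1 = k + 1 := by omega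
            rwa [this] at h3
        simp only [Pi.add_apply]
        omega

variable (S)

/-- From a live marking one can reach a marking with enough resources in the first `k` layers. -/
theorem exists_good {m₀ : P → ℕ} (hm₀ : N.IsLive m₀) (k : ℕ) :
    ∃ m, N.Reachable m₀ m ∧ S.Good k m := by
  classical
  induction k with
  | zero =>
    refine ⟨m₀, PetriNet.Reachable.refl N _, fun x hx => ?_⟩
    have := S.layer_pos x
    omega
  | succ k ih =>
    by_contra! hbad
    have hbad' : ∀ m, N.Reachable m₀ m → S.Good k m →
        ∃ x, S.pi3.layer x = k + 1 ∧ S.mass k m < potential S.pi3.bag x := by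
      intro m hr hg
      have h := hbad m hr
      simp only [Good, not_forall, not_le] at h
      obtain ⟨x, hx, hlt⟩ := h
      have hx' : S.pi3.layer x = k + 1 := by
        by_contra hne
        exact hlt.not_ge (hg x (by omega))
      exact ⟨x, hx', by simpa [hx'] using hlt⟩
    -- Extremal choice: these masses are bounded by the largest potential, since each such marking
    -- falls short of one.
    obtain ⟨m, ⟨hr, hg⟩, hmax⟩ : ∃ m, (N.Reachable m₀ m ∧ S.Good k m) ∧
        ∀ m', N.Reachable m₀ m' → S.Good k m' → S.mass k m' ≤ S.mass k m := by
      have hfin : ((fun m => S.mass k m) '' {m | N.Reachable m₀ m ∧ S.Good k m}).Finite := by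
        refine (Set.finite_Iio (Finset.univ.sup (potential S.pi3.bag))).subset ?_
        rintro _ ⟨m, ⟨hr, hg⟩, rfl⟩
        obtain ⟨x, -, hx⟩ := hbad' m hr hg
        exact hx.trans_le (Finset.le_sup (f := potential S.pi3.bag) (Finset.mem_univ x))
      obtain ⟨m, hm, h⟩ := Set.exists_max_image _ id hfin (Set.Nonempty.image _ ih)
      obtain ⟨m, hm, rfl⟩ := hm
      exact ⟨m, hm, fun m' hr hg => h _ ⟨m', ⟨hr, hg⟩, rfl⟩⟩
    obtain ⟨x, hx, hlt⟩ := hbad' m hr hg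
    have hkn : k < n := by
      have := S.layer_le x
      omega
    -- Otherwise moving that token to `x` would release resources, against maximality.
    have hyk : ∀ y, S.pi3.layer y = k + 1 → token y ≤ m →
        S.mass k m < potential S.pi3.bag y := by
      intro y hy hty
      by_contra! hle
      obtain ⟨m', hr', h', hmass⟩ := exists_jump (S.rearranges k) hy hx hg hty hle
      have := hmax m' (hr.trans hr') (hg.of_mass_le fun j hj => (mass_eq_of_jump hj hy hx h').ge)
      omega
    -- A token of layer `k` outside the maximal places could be moved into one, against maximality.
    have hlayer : S.layerMass k m = S.mass k m := by
      refine (Finset.sum_subset (fun p hp => ?_) fun p hp hp' => ?_).symm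
      · simpa using S.layer_of_mem_maxPlaces (Finset.mem_filter.1 hp).2
      · have hpk : S.pi3.layer (some p) = k := by simpa using hp
        replace hp' : p ∉ S.maxPlaces k := by simpa using hp'
        by_contra h0
        obtain ⟨y, hy, hymax⟩ := S.exists_maxPlace (x := some p)
        obtain ⟨j, rfl⟩ : ∃ j, k = j + 1 := ⟨k - 1, by
          have := S.layer_pos (some p)
          omega⟩
        have hpot : potential S.pi3.bag (some p) < potential S.pi3.bag y := by
          by_contra! hle
          exact hp' ⟨hpk, fun q hq => (hymax q (hq.trans hpk.symm)).trans hle⟩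
        obtain _ | q := y
        · rw [S.layer_ext] at hy
          omega
        have hq : q ∈ S.maxPlaces (j + 1) :=
          ⟨hy.trans hpk, fun z hz => hymax z (hz.trans hpk.symm)⟩
        obtain ⟨m', hr', h', hmass⟩ := exists_jump (S.rearranges j) hpk (hy.trans hpk)
          (hg.mono j.le_succ) (token_some_le (Nat.pos_of_ne_zero h0))
          (by simpa [hpk] using hg (some p) hpk.le)
        have hg' : S.Good (j + 1) m' := by
          refine hg.of_mass_le fun i hi => ?_
          obtain hi | rfl := Nat.lt_succ_iff_lt_or_eq.1 hi
          · exact (mass_eq_of_jump hi hpk (hy.trans hpk) h').ge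
          · omega
        have h1 : S.mass (j + 1) (m' + token (some p)) =
            S.mass (j + 1) (m + token (some q)) := by
          refine S.mass_congr fun r hr => h' r (S.notMem_maxPlaces ?_)
          rw [S.layer_of_mem_maxPlaces hr]
          omega
        have h2 : S.mass (j + 1) (token (some p)) = 0 := by
          refine Finset.sum_eq_zero fun r hr => ?_
          have : r ≠ p := fun h => hp' (h ▸ by simpa using hr)
          simp [token, this]
        rw [S.mass_add, S.mass_add, h2, S.mass_token hq] at h1
        have := hmax m' (hr.trans hr') hg'
        omega
    have hstuck : S.Stuck k (S.mass k m) m := ⟨hlayer, hyk⟩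
    have hinv : ∀ m', N.Reachable m m' → S.Stuck k (S.mass k m) m' := by
      intro m' h
      induction h with
      | refl => exact hstuck
      | tail _ h ih =>
        obtain ⟨t, ht⟩ := h
        refine ih.fires hkn (fun p hp => hlt.trans_le (hp.2 x hx)) ?_ ht
        by_cases hn : k + 1 = n
        · refine Or.inl (hyk none (S.layer_ext.trans hn.symm) ?_)
          rw [token_none]
          exact fun _ => Nat.zero_le _
        · exact Or.inr hn
    obtain ⟨t, y, hy, ht⟩ := S.exists_transition_of_place x
    obtain ⟨m', hr', hen⟩ := hm₀ t m hr
    exact (hinv m' hr').not_openBag_le (hy.trans hx) (ht ▸ hen)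

/-! ### Increments that can be repeated. -/

section Rays

theorem n_pos (S : OpenPi3 N n) : 1 ≤ n := S.layer_ext ▸ S.layer_pos none

/-- A token can be moved from `p_ext` to `p`. -/
theorem reachable_add_token {m : P → ℕ} (hm : S.Good n m) {p : P} (hp : p ∈ S.places n)
    {a b : P → ℕ} (ha : ∀ q ∉ S.maxPlaces (n - 1), a q = 0)
    (hb : ∀ q ∉ S.maxPlaces (n - 1), b q = 0)
    (hab : S.mass (n - 1) a + potential S.pi3.bag (some p) =
      S.mass (n - 1) b + potential S.pi3.bag none) :
    N.Reachable (m + a) (m + (b + token (some p))) := by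
  have hn := S.n_pos
  have hg := hm.add a
  have hp : S.pi3.layer (some p) = n := hp
  refine reachable_of_jump (S.rearranges (n - 1)) (x := none) (y := some p)
    (by rw [S.layer_ext]; omega) (by omega) (hg.mono (by omega)) ?_ ?_ (fun q hq => ?_) ?_
  · rw [token_none]
    exact fun _ => Nat.zero_le _
  · simpa [S.layer_ext] using hg none S.layer_ext.le
  · simp [ha q hq, hb q hq, token_none]
  · have := S.mass_token_of_layer_ne (j := n - 1) (x := some p) (by omega)
    simp only [S.mass_add]
    omega

theorem cin_of_mem {p : P} (hp : p ∈ S.places n) :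
    S.cin p = (potential S.pi3.bag none : ℤ) - potential S.pi3.bag (some p) := by
  have hp : S.pi3.layer (some p) = n := hp
  simp [cin, POT, pot, hp]

theorem mass_nsmul (j c : ℕ) (m : P → ℕ) : S.mass j (c • m) = c * S.mass j m := by
  simp [mass, Finset.mul_sum]

theorem nsmul_token_eq_zero {j c : ℕ} {r : P} (hr : r ∈ S.maxPlaces j) :
    ∀ q ∉ S.maxPlaces j, (c • token (some r) : P → ℕ) q = 0 := by
  intro q hq
  have : q ≠ r := fun h => hq (h ▸ hr)
  simp [token, this]

theorem reachable_add_of_cin_eq_zero {m : P → ℕ} (hm : S.Good n m) {p : P}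
    (hp : p ∈ S.places n) (hc : S.cin p = 0) : N.Reachable m (m + token (some p)) := by
  rw [S.cin_of_mem hp] at hc
  simpa using S.reachable_add_token hm hp (a := 0) (b := 0) (fun _ _ => rfl) (fun _ _ => rfl)
    (by omega)

theorem reachable_add_of_cin_neg {m : P → ℕ} (hm : S.Good n m) {q r : P}
    (hr : r ∈ S.maxPlaces (n - 1)) (hq : q ∈ S.places n) (hc : S.cin q < 0) :
    N.Reachable m (m + ((S.cin q).natAbs • token (some r) + token (some q))) := by
  rw [S.cin_of_mem hq] at hc ⊢
  have := S.reachable_add_token hm hq (a := 0)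
    (b := ((potential S.pi3.bag none : ℤ) - potential S.pi3.bag (some q)).natAbs • token (some r))
    (fun _ _ => rfl) (S.nsmul_token_eq_zero hr) (by
      rw [S.mass_nsmul, S.mass_token hr]
      simp only [mass, Pi.zero_apply, Finset.sum_const_zero]
      omega)
  simpa using this

theorem reachable_of_cin_pos {m : P → ℕ} (hm : S.Good n m) {p r : P}
    (hr : r ∈ S.maxPlaces (n - 1)) (hp : p ∈ S.places n) (hc : 0 < S.cin p) :
    N.Reachable (m + (S.cin p).natAbs • token (some r)) (m + token (some p)) := by
  rw [S.cin_of_mem hp] at hc ⊢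
  have := S.reachable_add_token hm hp (b := 0)
    (a := ((potential S.pi3.bag none : ℤ) - potential S.pi3.bag (some p)).natAbs • token (some r))
    (S.nsmul_token_eq_zero hr) (fun _ _ => rfl) (by
      rw [S.mass_nsmul, S.mass_token hr]
      simp only [mass, Pi.zero_apply, Finset.sum_const_zero]
      omega)
  simpa using this

/-- Drawing cin(p) tokens into `q` releases cin(p)·|cin(q)| resources, exactly what |cin(q)| draws
into `p` consume. -/
theorem reachable_add_of_cin_pos_of_cin_neg {m : P → ℕ} (hm : S.Good n m) {p q : P}
    (hp : p ∈ S.places n) (hq : q ∈ S.places n) (hcp : 0 < S.cin p) (hcq : S.cin q < 0) :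
    N.Reachable m
      (m + ((S.cin p).natAbs • token (some q) + (S.cin q).natAbs • token (some p))) := by
  classical
  have hq' : S.pi3.layer (some q) = n := hq
  -- Since cin(q) < 0, the potential of `q` is positive, so there are resource places.
  obtain ⟨r, hr⟩ : ∃ r, r ∈ S.maxPlaces (n - 1) := by
    by_contra! h
    have h1 := S.mass_openBag (some q)
    rw [hq', mass, Finset.filter_false_of_mem fun r _ => h r, Finset.sum_empty] at h1
    rw [S.cin_of_mem hq] at hcq
    omega
  set c := (S.cin p).natAbs
  set d := (S.cin q).natAbs
  have h1 := (S.reachable_add_of_cin_neg hm hr hq hcq).add_nsmul c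
  have h2 : ∀ (k : ℕ) (u : P → ℕ), N.Reachable (m + u + (k * c) • token (some r))
      (m + u + k • token (some p)) := by
    intro k
    induction k with
    | zero => exact fun u => by simpa using PetriNet.Reachable.refl N (m + u)
    | succ k ih =>
      intro u
      have h3 := S.reachable_of_cin_pos (hm.add (u + (k * c) • token (some r))) hr hp hcp
      have h4 := ih (u + token (some p))
      convert h3.trans ?_ using 1
      · rw [add_mul, one_mul, add_smul]
        simp only [add_assoc]
        rfl
      · convert h4 using 1
        · abel
        · rw [add_smul, one_smul]
          abel
  convert h1.trans ?_ using 1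
  convert h2 d (c • token (some q)) using 1
  · rw [smul_add, smul_smul, mul_comm d c]
    abel
  · rw [add_assoc]

end Rays

end OpenPi3

/-! ### Summability of the product-form measure. -/

namespace PetriNet

variable {P T : Type*} [Fintype P] {N : PetriNet P T} {ℓ : P → ℝ}

theorem productMeasure_pos (ℓ : P → ℝ) (m : P → ℕ) : 0 < productMeasure ℓ m := Real.exp_pos _

theorem summable_productMeasure (hℓ : ∀ p, ℓ p < 0) :
    Summable fun m : P → ℕ => productMeasure ℓ m := by
  classical
  have hpow : ∀ (m : P → ℕ), productMeasure ℓ m = ∏ p, Real.exp (ℓ p) ^ m p := fun m => by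
    simp [productMeasure, Real.exp_sum, ← Real.exp_nat_mul]
  have hgeom : ∀ p, Summable fun k : ℕ => Real.exp (ℓ p) ^ k := fun p =>
    summable_geometric_of_lt_one (Real.exp_pos _).le (Real.exp_lt_one_iff.2 (hℓ p))
  refine summable_of_sum_le (c := ∏ p, ∑' k : ℕ, Real.exp (ℓ p) ^ k)
    (fun m => (Real.exp_pos _).le) fun s => ?_
  -- A finite set of markings lies in a box, over which the sum factors into partial geometric sums.
  have hs : s ⊆ Fintype.piFinset fun p => Finset.range (s.sup (fun m => m p) + 1) := by
    intro m hm
    rw [Fintype.mem_piFinset]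
    intro p
    rw [Finset.mem_range]
    exact Nat.lt_succ_of_le (Finset.le_sup (f := fun m : P → ℕ => m p) hm)
  calc ∑ m ∈ s, productMeasure ℓ m
      ≤ ∑ m ∈ Fintype.piFinset fun p => Finset.range (s.sup (fun m => m p) + 1),
          ∏ p, Real.exp (ℓ p) ^ m p := by
        simp only [hpow]
        exact Finset.sum_le_sum_of_subset_of_nonneg hs fun m _ _ =>
          Finset.prod_nonneg fun p _ => (pow_pos (Real.exp_pos _) _).le
    _ = ∏ p, ∑ k ∈ Finset.range (s.sup (fun m => m p) + 1), Real.exp (ℓ p) ^ k :=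
        (Finset.prod_univ_sum _ _).symm
    _ ≤ ∏ p, ∑' k : ℕ, Real.exp (ℓ p) ^ k := by
        refine Finset.prod_le_prod (fun p _ => Finset.sum_nonneg fun k _ =>
          (pow_pos (Real.exp_pos _) _).le) fun p _ => ?_
        exact (hgeom p).sum_le_tsum _ fun k _ => (pow_pos (Real.exp_pos _) _).le

/-- The product-form measure is finite if some invariant of the net makes all constants less
than one. -/
theorem summable_productMeasure_of_invariant {y : P → ℝ}
    (hy : ∀ t, ∑ p, N.post t p * y p = ∑ p, N.pre t p * y p) (hℓ : ∀ p, ℓ p < y p)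
    (m₀ : P → ℕ) : Summable fun m : N.State m₀ => productMeasure ℓ m := by
  have hinv : ∀ m, N.Reachable m₀ m → ∑ p, m p * y p = ∑ p, m₀ p * y p := by
    intro m h
    induction h with
    | refl => rfl
    | tail _ h ih =>
      obtain ⟨t, ht⟩ := h
      obtain ⟨u, rfl, rfl⟩ := N.fires_iff.1 ht
      rw [← ih]
      simp [add_mul, Finset.sum_add_distrib, hy t]
  have hs := ((summable_productMeasure (ℓ := fun p => ℓ p - y p)
    fun p => sub_neg.2 (hℓ p)).comp_injective
      (Subtype.val_injective (p := N.Reachable m₀))).mul_left (Real.exp (∑ p, m₀ p * y p))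
  refine hs.congr fun m => ?_
  simp only [Function.comp_apply, productMeasure]
  rw [← Real.exp_add, ← hinv m m.2, ← Finset.sum_add_distrib]
  congr 1
  exact Finset.sum_congr rfl fun p _ => by ring

/-- If the product-form measure is finite, then it decreases along every increment that can be
repeated. -/
theorem sum_neg_of_summable {m₀ m u : P → ℕ} (hm : N.Reachable m₀ m)
    (hu : N.Reachable m (m + u)) (hu0 : u ≠ 0)
    (hs : Summable fun m : N.State m₀ => productMeasure ℓ m) : ∑ p, u p * ℓ p < 0 := by
  -- The markings m + k u are distinct states, and along them the measure is geometric.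
  have hinj : Function.Injective fun k : ℕ =>
      (⟨m + k • u, hm.trans (hu.add_nsmul k)⟩ : N.State m₀) := by
    intro k l hkl
    obtain ⟨p, hp⟩ := Function.ne_iff.1 hu0
    have h1 : m p + k * u p = m p + l * u p := congrFun (congrArg Subtype.val hkl) p
    exact Nat.eq_of_mul_eq_mul_right (Nat.pos_of_ne_zero hp) (Nat.add_left_cancel h1)
  have h1 := (hs.comp_injective hinj).mul_left (productMeasure ℓ m)⁻¹
  have h2 : ∀ k : ℕ, (productMeasure ℓ m)⁻¹ * productMeasure ℓ (m + k • u) =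
      productMeasure ℓ u ^ k := fun k => by
    rw [productMeasure_add, inv_mul_cancel_left₀ (productMeasure_pos _ _).ne', productMeasure,
      productMeasure, ← Real.exp_nat_mul, Finset.mul_sum]
    congr 1
    refine Finset.sum_congr rfl fun p _ => ?_
    simp only [Pi.smul_apply, smul_eq_mul]
    push_cast
    ring
  have h3 : Summable fun k : ℕ => productMeasure ℓ u ^ k := h1.congr h2
  rw [summable_geometric_iff_norm_lt_one, Real.norm_of_nonneg (productMeasure_pos _ _).le] at h3
  exact Real.exp_lt_one_iff.1 h3

end PetriNet

/-! ### Conservation laws and the stability criterion. -/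

namespace OpenPi3

variable {P T : Type*} [Fintype P] [Fintype T] {N : PetriNet P T} {n : ℕ} (S : OpenPi3 N n)

theorem POT_of_ne {i : ℕ} (hi : i ≠ n) {p : P} (hp : S.pi3.layer (some p) = i) :
    S.pot p ≤ S.POT i := by
  classical
  rw [POT, if_neg hi]
  exact Finset.le_sup (f := S.pot) (Finset.mem_filter.2 ⟨Finset.mem_univ p, hp⟩)

theorem cin_of_mem_maxPlaces {j : ℕ} (hj : j ≠ n) {p : P} (hp : p ∈ S.maxPlaces j) :
    S.cin p = 0 := by
  classical
  rw [cin, S.layer_of_mem_maxPlaces hp, sub_eq_zero, Nat.cast_inj]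
  refine le_antisymm ?_ (S.POT_of_ne hj hp.1)
  rw [POT, if_neg hj]
  exact Finset.sup_le fun q hq => hp.2 _ (Finset.mem_filter.1 hq).2

theorem cin_nonneg {p : P} (hp : S.pi3.layer (some p) ≠ n) : 0 ≤ S.cin p := by
  have := S.POT_of_ne hp rfl
  rw [cin]
  omega

theorem one_le_cin {p : P} (hp : S.pi3.layer (some p) ≠ n)
    (hp' : p ∉ S.maxPlaces (S.pi3.layer (some p))) : 1 ≤ S.cin p := by
  obtain ⟨q, hq, hlt⟩ : ∃ q, S.pi3.layer q = S.pi3.layer (some p) ∧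
      potential S.pi3.bag (some p) < potential S.pi3.bag q := by
    by_contra! h
    exact hp' ⟨rfl, h⟩
  obtain _ | q := q
  · exact absurd (hq.symm.trans S.layer_ext) hp
  · have h1 : S.pot q ≤ _ := S.POT_of_ne hp hq
    have h2 : S.pot p < S.pot q := hlt
    rw [cin]
    omega

/-- The conservation law of the net that is given by one number for each of the layers `1`, …,
`n - 1`. -/
noncomputable def weight (z : ℕ → ℝ) (p : P) : ℝ :=
  z (S.pi3.layer (some p)) + S.cin p * z (S.pi3.layer (some p) - 1)

/-- A place contributes z_i + (POT_i - pot) z_{i-1}; its pot resources have cin = 0 and weight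
z_{i-1} each, so the potential cancels. For the deleted place, z_n = 0 and POT_n = pot make the
missing token harmless. -/
theorem sum_openBag_mul_weight {z : ℕ → ℝ} (hz : z n = 0) (x : Option P) :
    ∑ p, S.openBag x p * S.weight z p =
      z (S.pi3.layer x) + S.POT (S.pi3.layer x) * z (S.pi3.layer x - 1) := by
  classical
  have hx := S.layer_pos x
  have hxn := S.layer_le x
  have h1 : ∀ p, (S.openBag x p : ℝ) * S.weight z p = token x p * S.weight z p +
      if p ∈ S.maxPlaces (S.pi3.layer x - 1) then S.openBag x p * z (S.pi3.layer x - 1)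
        else 0 := by
    intro p
    by_cases hp : p ∈ S.maxPlaces (S.pi3.layer x - 1)
    · have hl := S.layer_of_mem_maxPlaces hp
      rw [S.token_of_layer_ne (x := x) (p := p) (by omega), if_pos hp, weight, hl,
        S.cin_of_mem_maxPlaces (by omega) hp]
      simp
    · simp [S.openBag_eq_token hp, hp]
  rw [Finset.sum_congr rfl fun p _ => h1 p, Finset.sum_add_distrib, ← Finset.sum_filter,
    ← Finset.sum_mul, ← Nat.cast_sum]
  have h2 : ∑ p with p ∈ S.maxPlaces (S.pi3.layer x - 1), S.openBag x p =
      potential S.pi3.bag x := S.mass_openBag x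
  rw [h2]
  obtain _ | p := x
  · simp [token, S.layer_ext, hz, POT]
  · rw [Finset.sum_eq_single_of_mem p (Finset.mem_univ p) fun q _ hq => by simp [token, hq]]
    simp only [token, if_true, weight, cin, pot]
    push_cast
    ring

theorem weight_invariant {z : ℕ → ℝ} (hz : z n = 0) (t : T) :
    ∑ p, N.post t p * S.weight z p = ∑ p, N.pre t p * S.weight z p := by
  obtain ⟨x, y, h, -, -, hx, hy⟩ := S.exists_transition t
  rw [hx, hy, S.sum_openBag_mul_weight hz, S.sum_openBag_mul_weight hz, h]

variable {ℓ : P → ℝ}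

/-- The ergodicity criterion, for the logarithms `ℓ` of the product-form constants. -/
def IsStable (ℓ : P → ℝ) : Prop :=
  (∀ p ∈ S.places n, S.cin p = 0 → ℓ p < 0) ∧
  (∀ p ∈ S.places n, ∀ q ∈ S.places n, 0 < S.cin p → S.cin q < 0 →
    (|S.cin q| : ℤ) * ℓ p + S.cin p * ℓ q < 0) ∧
  (∀ p ∈ S.maxPlaces (n - 1), ∀ q ∈ S.places n, S.cin q < 0 →
    (|S.cin q| : ℤ) * ℓ p + ℓ q < 0)

variable {S}

theorem IsStable.summable (h : S.IsStable ℓ) (m₀ : P → ℕ) :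
    Summable fun m : N.State m₀ => PetriNet.productMeasure ℓ m := by
  classical
  obtain ⟨h1, h2, h3⟩ := h
  have hn := S.n_pos
  -- The value z_{n-1} = s must lie above ℓ/cin where cin > 0 and above ℓ on P_{n-1}^max, and below
  -- ℓ/cin where cin < 0. Conditions 2 and 3 say that these bounds are compatible.
  obtain ⟨s, hlo, hhi⟩ := Order.exists_between_finsets
    ((({p | p ∈ S.places n ∧ 0 < S.cin p} : Finset P).image fun p => ℓ p / S.cin p) ∪
      ({p | p ∈ S.maxPlaces (n - 1)} : Finset P).image ℓ)
    (({q | q ∈ S.places n ∧ S.cin q < 0} : Finset P).image fun q => ℓ q / S.cin q) (by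
      simp only [Finset.mem_union, Finset.mem_image, Finset.mem_filter, Finset.mem_univ, true_and]
      rintro _ (⟨p, ⟨hp, hcp⟩, rfl⟩ | ⟨p, hp, rfl⟩) _ ⟨q, ⟨hq, hcq⟩, rfl⟩
      · have := h2 p hp q hq hcp hcq
        rw [abs_of_neg hcq] at this
        push_cast at this
        have hcp' : (0 : ℝ) < S.cin p := by exact_mod_cast hcp
        have hcq' : (S.cin q : ℝ) < 0 := by exact_mod_cast hcq
        rw [lt_div_iff_of_neg hcq', div_mul_eq_mul_div, lt_div_iff₀ hcp']
        linarith
      · have := h3 p hp q hq hcq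
        rw [abs_of_neg hcq] at this
        push_cast at this
        have hcq' : (S.cin q : ℝ) < 0 := by exact_mod_cast hcq
        rw [lt_div_iff_of_neg hcq']
        linarith)
  simp only [Finset.mem_union, Finset.mem_image, Finset.mem_filter, Finset.mem_univ,
    true_and] at hlo hhi
  -- The margin |s| serves the nonmaximal places of layer n - 1, whose weight s + cin · b is at
  -- least b - |s|.
  set b : ℝ := 1 + |s| + ∑ p, |ℓ p| with hb
  have hℓb : ∀ p, ℓ p < b - |s| := fun p => by
    have h1 := Finset.single_le_sum (f := fun p => |ℓ p|) (fun p _ => abs_nonneg _)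
      (Finset.mem_univ p)
    have h2 := le_abs_self (ℓ p)
    linarith
  have hb0 : 0 ≤ b := by positivity
  have hs0 := abs_nonneg s
  have hs1 := neg_abs_le s
  set z : ℕ → ℝ := fun j => if j = n then 0 else if j + 1 = n then s else b with hz
  refine PetriNet.summable_productMeasure_of_invariant (y := S.weight z)
    (S.weight_invariant (by simp [hz])) (fun p => ?_) m₀
  have hp1 := S.layer_pos (some p)
  have hpn := S.layer_le (some p)
  rw [weight]
  by_cases hl : S.pi3.layer (some p) = n
  · have hz1 : z (S.pi3.layer (some p)) = 0 := by simp [hz, hl]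
    have hz2 : z (S.pi3.layer (some p) - 1) = s := by
      simp only [hz]
      rw [if_neg (by omega), if_pos (by omega)]
    rw [hz1, hz2, zero_add]
    obtain hc | hc | hc := lt_trichotomy (S.cin p) 0
    · have hc' : (S.cin p : ℝ) < 0 := by exact_mod_cast hc
      have := hhi _ ⟨p, ⟨hl, hc⟩, rfl⟩
      rw [lt_div_iff_of_neg hc'] at this
      linarith
    · simpa [hc] using h1 p hl hc
    · have hc' : (0 : ℝ) < S.cin p := by exact_mod_cast hc
      have := hlo _ (Or.inl ⟨p, ⟨hl, hc⟩, rfl⟩)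
      rw [div_lt_iff₀ hc'] at this
      linarith
  · have hz2 : z (S.pi3.layer (some p) - 1) = b := by
      simp only [hz]
      rw [if_neg (by omega), if_neg (by omega)]
    have hc0 : (0 : ℝ) ≤ S.cin p := by exact_mod_cast S.cin_nonneg hl
    rw [hz2]
    by_cases hl' : S.pi3.layer (some p) + 1 = n
    · have hz1 : z (S.pi3.layer (some p)) = s := by simp [hz, hl, hl']
      rw [hz1]
      by_cases hp : p ∈ S.maxPlaces (S.pi3.layer (some p))
      · rw [S.cin_of_mem_maxPlaces hl hp]
        have := hlo (ℓ p) (Or.inr ⟨p, by rwa [show n - 1 = S.pi3.layer (some p) by omega], rfl⟩)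
        simpa using this
      · have hc1 : (1 : ℝ) ≤ S.cin p := by exact_mod_cast S.one_le_cin hl hp
        nlinarith [hℓb p]
    · have hz1 : z (S.pi3.layer (some p)) = b := by simp [hz, hl, hl']
      rw [hz1]
      nlinarith [hℓb p, mul_nonneg hc0 hb0]

theorem isStable_of_summable {m₀ : P → ℕ} (hm₀ : N.IsLive m₀)
    (hs : Summable fun m : N.State m₀ => PetriNet.productMeasure ℓ m) : S.IsStable ℓ := by
  classical
  obtain ⟨m, hm, hg⟩ := S.exists_good hm₀ n
  have hne : ∀ (u : P → ℕ) (p : P), u + token (some p) ≠ 0 := fun u p h => by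
    simpa [token] using congrFun h p
  have htok : ∀ p, ∑ q, (token (some p) q : ℝ) * ℓ q = ℓ p := fun p => by
    simp [token, eq_comm]
  have hsmul : ∀ (c : ℕ) p, ∑ q, ((c • token (some p) : P → ℕ) q : ℝ) * ℓ q = c * ℓ p :=
    fun c p => by simp [mul_assoc, ← Finset.mul_sum, htok]
  have hadd : ∀ u v : P → ℕ, ∑ q, ((u + v) q : ℝ) * ℓ q =
      ∑ q, (u q : ℝ) * ℓ q + ∑ q, (v q : ℝ) * ℓ q := fun u v => by
    simp [add_mul, Finset.sum_add_distrib]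
  refine ⟨fun p hp hc => ?_, fun p hp q hq hcp hcq => ?_, fun p hp q hq hcq => ?_⟩
  · have := PetriNet.sum_neg_of_summable hm (S.reachable_add_of_cin_eq_zero hg hp hc)
      (by simpa using hne 0 p) hs
    rwa [htok] at this
  · have := PetriNet.sum_neg_of_summable hm
      (S.reachable_add_of_cin_pos_of_cin_neg hg hp hq hcp hcq) (fun h => ?_) hs
    · rw [hadd, hsmul, hsmul] at this
      rw [Int.abs_eq_natAbs, Int.cast_natCast]
      have h2 : (S.cin p : ℝ) = ((S.cin p).natAbs : ℝ) := by
        rw [Nat.cast_natAbs, abs_of_pos hcp]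
      rw [h2]
      linarith
    · have h1 := congrFun h p
      simp only [Pi.add_apply, Pi.smul_apply, token, if_true, smul_eq_mul, Pi.zero_apply] at h1
      omega
  · have := PetriNet.sum_neg_of_summable hm (S.reachable_add_of_cin_neg hg hp hq hcq)
      (hne _ q) hs
    rw [hadd, hsmul, htok] at this
    rwa [Int.abs_eq_natAbs, Int.cast_natCast]

/-- The right-hand side does not mention `m₀`, so all live markings behave alike. -/
theorem isErgodic_iff_isStable {rate : T → ℝ} (hrate : ∀ t, 0 < rate t) {μ : P → ℝ}
    (hμ : N.IsProductForm rate μ) {m₀ : P → ℕ} (hm₀ : N.IsLive m₀) :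
    N.IsErgodic rate m₀ ↔ S.IsStable fun p => Real.log (μ p) := by
  rw [hμ.isErgodic_iff_summable S.weaklyReversible hrate]
  exact ⟨isStable_of_summable hm₀, fun h => h.summable m₀⟩

theorem exists_isProductForm (S : OpenPi3 N n) {rate : T → ℝ} (hrate : ∀ t, 0 < rate t) :
    ∃ μ : P → ℝ, N.IsProductForm rate μ := by
  obtain ⟨wit, hwit⟩ := S.exists_isWitness
  obtain ⟨vis, hvis⟩ := S.weaklyReversible.exists_isVisit hrate
  exact ⟨_, wit, vis, fun b _ => hwit b, hvis, fun _ => rfl⟩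

end OpenPi3

theorem zpow_mul_zpow_lt_one_iff {x y : ℝ} (hx : 0 < x) (hy : 0 < y) (a b : ℤ) :
    x ^ a * y ^ b < 1 ↔ a * Real.log x + b * Real.log y < 0 := by
  rw [← Real.log_neg_iff (by positivity), Real.log_mul (by positivity) (by positivity),
    Real.log_zpow, Real.log_zpow]

theorem mainTheorem2 {P T : Type*} [Fintype P] [Fintype T] (N : PetriNet P T) (n : ℕ)
    (S : OpenPi3 N n) (rate : T → ℝ) (hrate : ∀ t, 0 < rate t) :
    (∃ μ : P → ℝ, N.IsProductForm rate μ) ∧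
    (∀ μ : P → ℝ, N.IsProductForm rate μ → ∀ m₀ : P → ℕ, N.IsLive m₀ →
      (N.IsErgodic rate m₀ ↔
        (∀ p ∈ S.places n, S.cin p = 0 → μ p < 1) ∧
        (∀ p ∈ S.places n, ∀ q ∈ S.places n, 0 < S.cin p → S.cin q < 0 →
          μ p ^ |S.cin q| * μ q ^ S.cin p < 1) ∧
        (∀ p ∈ S.maxPlaces (n - 1), ∀ q ∈ S.places n, S.cin q < 0 →
          μ p ^ |S.cin q| * μ q < 1))) ∧
    (∀ m₀ m₁ : P → ℕ, N.IsLive m₀ → N.IsLive m₁ →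
      (N.IsErgodic rate m₀ ↔ N.IsErgodic rate m₁)) := by
  obtain ⟨μ₀, hμ₀⟩ := S.exists_isProductForm hrate
  refine ⟨⟨μ₀, hμ₀⟩, fun μ hμ m₀ hm₀ => ?_, fun m₀ m₁ hm₀ hm₁ => ?_⟩
  · have hpos := hμ.pos S.weaklyReversible hrate
    rw [OpenPi3.isErgodic_iff_isStable (S := S) hrate hμ hm₀]
    have h1 : ∀ p, Real.log (μ p) < 0 ↔ μ p < 1 := fun p => Real.log_neg_iff (hpos p)
    have h2 : ∀ p q (a : ℤ), a * Real.log (μ p) + Real.log (μ q) < 0 ↔ μ p ^ a * μ q < 1 :=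
      fun p q a => by simpa using (zpow_mul_zpow_lt_one_iff (hpos p) (hpos q) a 1).symm
    simp only [OpenPi3.IsStable, h1, h2, ← zpow_mul_zpow_lt_one_iff (hpos _) (hpos _)]
  · rw [OpenPi3.isErgodic_iff_isStable (S := S) hrate hμ₀ hm₀,
      OpenPi3.isErgodic_iff_isStable (S := S) hrate hμ₀ hm₁]
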